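/- Let $\kappa>0$ and $\ell\in\mathbb Z$. On $\mathbb C^2\setminus\{0\}$, with coordinates $(z_1,z_2)$, put $$s=|z_1|^2+|z_2|^2,\qquad F=\sqrt{1+\kappa/s^2},\qquad f=\sqrt{1+\kappa/s^2}+\sqrt\kappa/s ,$$ and consider the Eguchi--Hanson metric $$g=\frac1s\Big(F\,|z_1dz_2-z_2dz_1|^2+F^{-1}\,|\bar z_1dz_1+\bar z_2dz_2|^2\Big).$$ (The coordinates $(z_1,z_2)$ parametrise, two-to-one, the Eguchi--Hanson space minus its bolt, a set of measure zero; spinors are regarded here as forms in these coordinates, so they are allowed to change sign under $z\mapsto -z$, and nothing is required at the bolt.) Let $\bar\partial^*$ be the formal adjoint of $\bar\partial$ on $\Lambda^{0,\bullet}$ with respect to $g$, let $$\mathcal A=\ell\,(A-\bar A),\qquad A=\frac{\sqrt\kappa}{2s^2F}\,(z_1d\bar z_1+z_2d\bar z_2),$$ and let $D_{\mathcal A}\sigma=\bar\partial\sigma-\bar\partial^*\sigma+\mathcal A\cdot\sigma$ be the twisted Dirac operator on $\Lambda^{0,\bullet}$, with the Clifford action $\upsilon\cdot\sigma=\upsilon^{0,1}\wedge\sigma+\iota_{\upsilon^\sharp}\sigma$.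 A zero mode is a smooth $\sigma$ on $\mathbb C^2\setminus\{0\}$ with $D_{\mathcal A}\sigma=0$; it is normalisable ($L^2$) if $\int|\sigma|_g^2\,\mathrm{vol}_g<\infty$. For $N\in\{0,\tfrac12,1,\tfrac32,\dots\}$ and $m\in\{-N,-N+1,\dots,N\}$ let $$\sigma_{N,m}=\frac{z_1^{N-m}z_2^{N+m}}{F\,s^{2N+2}\,f^{\ell/2}}\,(z_1d\bar z_1+z_2d\bar z_2).$$ Then: 1. Every $\sigma_{N,m}$ is a zero mode; the $\sigma_{N,m}$ are linearly independent over $\mathbb C$, and every finite linear combination of them is a zero mode. 2. $\sigma_{N,m}$ is $L^2$ if and only if $1\le 2N+1\le\ell$. 3. For each $N$, the span $V_N$ of the $\sigma_{N,m}$, $m=-N,\dots,N$, has dimension $2N+1$, is invariant under the action of $SU(2)$ by pullback along $z\mapsto Uz$, and is irreducible. 4. The $L^2$ elements of the span of all the $\sigma_{N,m}$ form the space $\sum_{2N+1\le\ell}V_N$. For $\ell\ge0$ it has dimension $\ell(\ell+1)/2$; for $\ell=0$ it is zero. -/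

import Mathlib

open MeasureTheory Matrix
open scoped ContDiff

namespace EguchiHanson

noncomputable section

/-- The coordinate space of the complex coordinates `(z₁, z₂) = (z 0, z 1)`. All geometric objects
below live on the punctured space `z ≠ 0`; values at `z = 0` are never used. -/
abbrev C2 : Type := Fin 2 → ℂ

/-- `s = |z₁|² + |z₂|²`. -/
def s (z : C2) : ℝ := Complex.normSq (z 0) + Complex.normSq (z 1)

/-- `F = √(1 + κ / s²)`. -/
def F (κ : ℝ) (z : C2) : ℝ := √(1 + κ / s z ^ 2)

/-- `f = √(1 + κ / s²) + √κ / s`. -/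
def f (κ : ℝ) (z : C2) : ℝ := √(1 + κ / s z ^ 2) + √κ / s z

/-- The Eguchi-Hanson metric, as the matrix `G i j` of the coefficients of `dzᵢ dz̄ⱼ` in
`(1/s) (F |z₁ dz₂ - z₂ dz₁|² + F⁻¹ |z̄₁ dz₁ + z̄₂ dz₂|²)`. -/
def metric (κ : ℝ) (z : C2) : Matrix (Fin 2) (Fin 2) ℂ :=
  ((s z)⁻¹ : ℂ) •
    ((F κ z : ℂ) • vecMulVec ![-z 1, z 0] (star ![-z 1, z 0]) +
      ((F κ z)⁻¹ : ℂ) • vecMulVec (star z) z)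

/-- The density `v_g = det G` of the Riemannian volume with respect to the Lebesgue measure
of `ℂ² = ℝ⁴`. -/
def volDensity (κ : ℝ) (z : C2) : ℝ := (metric κ z).det.re

/-- Value at a point of a form in `Λ^{0,0} ⊕ Λ^{0,1} ⊕ Λ^{0,2}`: the triple `(α, (β, γ), δ)` stands
for `α + β dz̄₁ + γ dz̄₂ + δ dz̄₁ ∧ dz̄₂`. -/
abbrev Spinor : Type := ℂ × (Fin 2 → ℂ) × ℂ

/-- A field of forms in `Λ^{0,•}`. -/
abbrev SpinorField : Type := C2 → Spinor

/-- The Hermitian inner product on `Λ^{0,•}` induced by the metric (linear in `σ`). -/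
def herm (κ : ℝ) (z : C2) (σ τ : Spinor) : ℂ :=
  σ.1 * star τ.1 + σ.2.1 ⬝ᵥ ((metric κ z)⁻¹ *ᵥ star τ.2.1) +
    (metric κ z).det⁻¹ * σ.2.2 * star τ.2.2

/-- The Wirtinger derivative `∂/∂z̄ᵢ`. -/
def dzbar (i : Fin 2) (u : C2 → ℂ) (z : C2) : ℂ :=
  (fderiv ℝ u z (Pi.single i 1) + Complex.I * fderiv ℝ u z (Pi.single i Complex.I)) / 2

/-- The Dolbeault operator `∂̄` on `Λ^{0,•}`. -/
def dbar (σ : SpinorField) (z : C2) : Spinor :=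
  (0, fun i => dzbar i (fun y => (σ y).1) z,
    dzbar 0 (fun y => (σ y).2.1 1) z - dzbar 1 (fun y => (σ y).2.1 0) z)

/-- Smooth test forms with compact support in `ℂ² ∖ {0}`. -/
def IsTest (φ : SpinorField) : Prop :=
  ContDiff ℝ ∞ φ ∧ HasCompactSupport φ ∧ (0 : C2) ∉ tsupport φ

/-- `τ = ∂̄* σ` on `ℂ² ∖ {0}`, where `∂̄*` is the formal adjoint of `∂̄` for the `L²` pairing of the
Eguchi-Hanson metric. -/
def IsDbarStar (κ : ℝ) (σ τ : SpinorField) : Prop :=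
  ContDiffOn ℝ ∞ τ {0}ᶜ ∧
    ∀ φ : SpinorField, IsTest φ →
      ∫ z, herm κ z (dbar φ z) (σ z) * (volDensity κ z : ℂ) =
        ∫ z, herm κ z (φ z) (τ z) * (volDensity κ z : ℂ)

/-- Value at a point of a complex 1-form `∑ aᵢ dzᵢ + ∑ bᵢ dz̄ᵢ`, as the pair `(a, b)`. -/
abbrev OneForm : Type := (Fin 2 → ℂ) × (Fin 2 → ℂ)

/-- Complex conjugation of 1-forms. -/
def OneForm.conj (υ : OneForm) : OneForm := (star υ.2, star υ.1)

/-- `A = √κ / (2 s² F) (z₁ dz̄₁ + z₂ dz̄₂)`. -/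
def potential (κ : ℝ) (z : C2) : OneForm :=
  (0, ((√κ / (2 * s z ^ 2 * F κ z) : ℝ) : ℂ) • z)

/-- The connection form `𝒜 = ℓ (A - Ā)`. -/
def connection (κ : ℝ) (ℓ : ℤ) (z : C2) : OneForm :=
  (ℓ : ℂ) • (potential κ z - (potential κ z).conj)

/-- The components `dz̄ᵢ(υ^♯)` of the metric dual of (the `(1,0)` part of) `υ`. -/
def sharp (κ : ℝ) (z : C2) (υ : OneForm) : Fin 2 → ℂ := (metric κ z)⁻¹ *ᵥ υ.1

/-- The Clifford action `υ · σ = υ^{0,1} ∧ σ + ι_{υ^♯} σ`. -/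
def clifford (κ : ℝ) (z : C2) (υ : OneForm) (σ : Spinor) : Spinor :=
  (sharp κ z υ ⬝ᵥ σ.2.1,
    σ.1 • υ.2 + σ.2.2 • ![-sharp κ z υ 1, sharp κ z υ 0],
    υ.2 0 * σ.2.1 1 - υ.2 1 * σ.2.1 0)

/-- `σ` is a smooth solution on `ℂ² ∖ {0}` of `D_𝒜 σ = ∂̄ σ - ∂̄* σ + 𝒜 · σ = 0`. -/
def IsZeroMode (κ : ℝ) (ℓ : ℤ) (σ : SpinorField) : Prop :=
  ContDiffOn ℝ ∞ σ {0}ᶜ ∧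
    ∃ τ : SpinorField, IsDbarStar κ σ τ ∧
      ∀ z : C2, z ≠ 0 → dbar σ z - τ z + clifford κ z (connection κ ℓ z) (σ z) = 0

/-- `σ` is normalisable: `∫ |σ|² vol_g < ∞`. -/
def IsL2 (κ : ℝ) (σ : SpinorField) : Prop :=
  AEStronglyMeasurable σ volume ∧
    Integrable (fun z => (herm κ z (σ z) (σ z)).re * volDensity κ z) volume

/-- The mode `z₁^a z₂^b / (F s^{2N+2} f^{ℓ/2}) (z₁ dz̄₁ + z₂ dz̄₂)`, where `a = N - m` and `b = N + m`,
so that `2 N = a + b`. -/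
def mode (κ : ℝ) (ℓ : ℤ) (a b : ℕ) : SpinorField := fun z =>
  (0, (z 0 ^ a * z 1 ^ b /
    ((F κ z * s z ^ (a + b + 2) * f κ z ^ ((ℓ : ℝ) / 2) : ℝ) : ℂ)) • z, 0)

/-- The span of the modes with `2 N = n`. -/
def multiplet (κ : ℝ) (ℓ : ℤ) (n : ℕ) : Submodule ℂ SpinorField :=
  Submodule.span ℂ {σ | ∃ a b : ℕ, a + b = n ∧ σ = mode κ ℓ a b}

/-- The span of all the modes. -/
def modeSpace (κ : ℝ) (ℓ : ℤ) : Submodule ℂ SpinorField :=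
  Submodule.span ℂ {σ | ∃ a b : ℕ, σ = mode κ ℓ a b}

/-- Pullback of forms in `Λ^{0,•}` along the linear map `z ↦ U z`. -/
def pullback (U : Matrix (Fin 2) (Fin 2) ℂ) (σ : SpinorField) : SpinorField := fun z =>
  ((σ (U *ᵥ z)).1, (σ (U *ᵥ z)).2.1 ᵥ* U.map star, star U.det * (σ (U *ᵥ z)).2.2)

/-- Invariance of a space of forms under the action of `SU(2)` by pullback. -/
def IsSU2Invariant (W : Submodule ℂ SpinorField) : Prop :=
  ∀ U ∈ specialUnitaryGroup (Fin 2) ℂ, ∀ σ ∈ W, pullback U σ ∈ W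

end

end EguchiHanson

namespace EguchiHanson

/-! ### Pointwise algebra of the metric -/

lemma s_pos {z : C2} (hz : z ≠ 0) : 0 < s z := by
  unfold s
  by_contra h
  have h0 := Complex.normSq_nonneg (z 0)
  have h1 := Complex.normSq_nonneg (z 1)
  have h0' : z 0 = 0 := Complex.normSq_eq_zero.1 (by linarith)
  have h1' : z 1 = 0 := Complex.normSq_eq_zero.1 (by linarith)
  exact hz (funext (Fin.forall_fin_two.2 ⟨h0', h1'⟩))

lemma F_pos {κ : ℝ} (hκ : 0 < κ) (z : C2) : 0 < F κ z := by
  unfold F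
  positivity

lemma s_nonneg (z : C2) : 0 ≤ s z :=
  add_nonneg (Complex.normSq_nonneg _) (Complex.normSq_nonneg _)

lemma f_pos {κ : ℝ} (hκ : 0 < κ) (z : C2) : 0 < f κ z := by
  have := F_pos hκ z
  have := s_nonneg z
  unfold f
  unfold F at *
  positivity

lemma ofReal_s (z : C2) : ((s z : ℝ) : ℂ) = z 0 * star (z 0) + z 1 * star (z 1) := by
  simp [s, Complex.mul_conj]

lemma ofReal_s_eq_dotProduct (z : C2) : ((s z : ℝ) : ℂ) = star z ⬝ᵥ z := by
  rw [ofReal_s]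
  simp [dotProduct, Fin.sum_univ_two, mul_comm]

lemma metric_det {κ : ℝ} (hκ : 0 < κ) {z : C2} (hz : z ≠ 0) : (metric κ z).det = 1 := by
  have hs : (s z : ℂ) ≠ 0 := by exact_mod_cast (s_pos hz).ne'
  have hF : (F κ z : ℂ) ≠ 0 := by exact_mod_cast (F_pos hκ z).ne'
  have hsz := ofReal_s z
  simp only [metric, det_fin_two, Matrix.smul_apply, Matrix.add_apply, vecMulVec_apply, smul_eq_mul,
    Pi.star_apply, cons_val_zero, cons_val_one, star_neg]
  field_simp
  rw [hsz]
  ring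

lemma volDensity_eq_one {κ : ℝ} (hκ : 0 < κ) {z : C2} (hz : z ≠ 0) : volDensity κ z = 1 := by
  simp [volDensity, metric_det hκ hz]

lemma metric_mulVec_star {κ : ℝ} {z : C2} (hz : z ≠ 0) :
    metric κ z *ᵥ star z = ((F κ z)⁻¹ : ℂ) • star z := by
  have hs : (s z : ℂ) ≠ 0 := by exact_mod_cast (s_pos hz).ne'
  have hsz := ofReal_s z
  have h1 : star ![-z 1, z 0] ⬝ᵥ star z = 0 := by
    simp only [dotProduct, Fin.sum_univ_two, Pi.star_apply, cons_val_zero, cons_val_one, star_neg]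
    ring
  have h2 : z ⬝ᵥ star z = s z := by rw [ofReal_s_eq_dotProduct, dotProduct_comm]
  rw [metric, smul_mulVec, add_mulVec, smul_mulVec, smul_mulVec, vecMulVec_mulVec,
    vecMulVec_mulVec, h1, h2]
  funext i
  simp only [Pi.smul_apply, Pi.add_apply, smul_eq_mul, MulOpposite.op_zero, zero_smul,
    MulOpposite.smul_eq_mul_unop, MulOpposite.unop_op, mul_zero, zero_add, Pi.zero_apply]
  field_simp

lemma metric_inv_mulVec_star {κ : ℝ} (hκ : 0 < κ) {z : C2} (hz : z ≠ 0) :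
    (metric κ z)⁻¹ *ᵥ star z = (F κ z : ℂ) • star z := by
  have hF : (F κ z : ℂ) ≠ 0 := by exact_mod_cast (F_pos hκ z).ne'
  have h := congrArg (fun v => (F κ z : ℂ) • ((metric κ z)⁻¹ *ᵥ v)) (metric_mulVec_star (κ := κ) hz)
  have hu : IsUnit (metric κ z).det := by rw [metric_det hκ hz]; exact isUnit_one
  simp only [mulVec_mulVec, nonsing_inv_mul _ hu, one_mulVec, mulVec_smul, smul_smul,
    mul_inv_cancel₀ hF, one_smul] at h
  exact h.symm

/-! ### Radial `(0,1)`-forms -/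

/-- The form `h (z₁ dz̄₁ + z₂ dz̄₂)`. -/
def radialForm : (C2 → ℂ) →ₗ[ℂ] SpinorField where
  toFun h z := (0, h z • z, 0)
  map_add' h k := by
    funext z
    simp [add_smul]
  map_smul' c h := by
    funext z
    simp [mul_smul]

lemma radialForm_apply (h : C2 → ℂ) (z : C2) : radialForm h z = (0, h z • z, 0) := rfl

/-- The coefficient of `z₁ dz̄₁ + z₂ dz̄₂` in a mode. -/
noncomputable def modeCoeff (κ : ℝ) (ℓ : ℤ) (a b : ℕ) (z : C2) : ℂ :=
  z 0 ^ a * z 1 ^ b / ((F κ z * s z ^ (a + b + 2) * f κ z ^ ((ℓ : ℝ) / 2) : ℝ) : ℂ)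

lemma mode_eq (κ : ℝ) (ℓ : ℤ) (a b : ℕ) : mode κ ℓ a b = radialForm (modeCoeff κ ℓ a b) := rfl

lemma dotProduct_metric_inv {κ : ℝ} (hκ : 0 < κ) {z : C2} (hz : z ≠ 0) (v : C2) (c : ℂ) :
    v ⬝ᵥ ((metric κ z)⁻¹ *ᵥ star (c • z)) = F κ z * star c * (v ⬝ᵥ star z) := by
  rw [star_smul, mulVec_smul, metric_inv_mulVec_star hκ hz, dotProduct_smul, dotProduct_smul,
    smul_eq_mul, smul_eq_mul]
  ring

lemma herm_radialForm_right {κ : ℝ} (hκ : 0 < κ) {z : C2} (hz : z ≠ 0) (φ : Spinor) (h : C2 → ℂ) :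
    herm κ z φ (radialForm h z) = F κ z * star (h z) * (φ.2.1 ⬝ᵥ star z) := by
  simp only [herm, radialForm_apply, dotProduct_metric_inv hκ hz]
  simp

lemma herm_radialForm {κ : ℝ} (hκ : 0 < κ) {z : C2} (hz : z ≠ 0) (h : C2 → ℂ) :
    (herm κ z (radialForm h z) (radialForm h z)).re = ‖h z‖ ^ 2 * (F κ z * s z) := by
  rw [herm_radialForm_right hκ hz]
  have h1 : (radialForm h z).2.1 ⬝ᵥ star z = h z * (s z : ℂ) := by
    rw [radialForm_apply, smul_dotProduct, ofReal_s_eq_dotProduct, dotProduct_comm z, smul_eq_mul]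
  have h2 : (F κ z : ℂ) * star (h z) * (h z * (s z : ℂ)) =
      ((‖h z‖ ^ 2 * (F κ z * s z) : ℝ) : ℂ) := by
    have : star (h z) * h z = ((‖h z‖ ^ 2 : ℝ) : ℂ) := by
      rw [mul_comm]; push_cast; exact Complex.mul_conj' _
    push_cast at this ⊢
    linear_combination (F κ z : ℂ) * (s z : ℂ) * this
  rw [h1, h2, Complex.ofReal_re]

/-! ### Pullback along unitary maps -/

lemma s_mulVec {U : Matrix (Fin 2) (Fin 2) ℂ} (hU : Uᴴ * U = 1) (z : C2) : s (U *ᵥ z) = s z := by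
  have h : ((s (U *ᵥ z) : ℝ) : ℂ) = (s z : ℝ) := by
    rw [ofReal_s_eq_dotProduct, ofReal_s_eq_dotProduct, star_mulVec, ← dotProduct_mulVec,
      mulVec_mulVec, hU, one_mulVec]
  exact_mod_cast h

lemma F_mulVec (κ : ℝ) {U : Matrix (Fin 2) (Fin 2) ℂ} (hU : Uᴴ * U = 1) (z : C2) :
    F κ (U *ᵥ z) = F κ z := by
  simp only [F, s_mulVec hU]

lemma f_mulVec (κ : ℝ) {U : Matrix (Fin 2) (Fin 2) ℂ} (hU : Uᴴ * U = 1) (z : C2) :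
    f κ (U *ᵥ z) = f κ z := by
  simp only [f, s_mulVec hU]

lemma pullback_radialForm {U : Matrix (Fin 2) (Fin 2) ℂ} (hU : Uᴴ * U = 1) (h : C2 → ℂ) :
    pullback U (radialForm h) = radialForm (fun z => h (U *ᵥ z)) := by
  funext z
  have h1 : (U.map star)ᵀ = Uᴴ := rfl
  simp only [pullback, radialForm_apply, smul_vecMul, mul_zero]
  rw [← mulVec_transpose, h1, mulVec_mulVec, hU, one_mulVec]

/-- Pullback of forms as a linear map. -/
noncomputable def pullbackLinear (U : Matrix (Fin 2) (Fin 2) ℂ) : Module.End ℂ SpinorField where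
  toFun := pullback U
  map_add' σ τ := by
    funext z
    simp [pullback, add_vecMul, mul_add]
  map_smul' c σ := by
    funext z
    simp [pullback, smul_vecMul, mul_left_comm]

lemma pullbackLinear_apply (U : Matrix (Fin 2) (Fin 2) ℂ) (σ : SpinorField) :
    pullbackLinear U σ = pullback U σ := rfl

/-! ### Weight vectors in invariant subspaces -/

/-- A subspace invariant under `T` contains the components of its elements along eigenvectors
of `T` with distinct eigenvalues. -/
lemma mem_of_sum_mem_of_eigenvectors {K E ι : Type*} [Field K] [AddCommGroup E] [Module K E]
    (T : Module.End K E) (W : Submodule K E) (hW : ∀ x ∈ W, T x ∈ W) (μ : ι → K) (S : Finset ι) :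
    ∀ (v : ι → E), (∀ i ∈ S, T (v i) = μ i • v i) → Set.InjOn μ S → ∑ i ∈ S, v i ∈ W →
      ∀ i ∈ S, v i ∈ W := by
  classical
  induction S using Finset.induction_on with
  | empty => simp
  | insert a S ha ih =>
    intro v hv hμ hsum
    have hstep : ∑ i ∈ S, (μ i - μ a) • v i ∈ W := by
      have h := W.sub_mem (hW _ hsum) (W.smul_mem (μ a) hsum)
      rw [map_sum, Finset.smul_sum, ← Finset.sum_sub_distrib, Finset.sum_insert ha,
        hv a (Finset.mem_insert_self _ _), sub_self, zero_add] at h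
      convert h using 1
      refine Finset.sum_congr rfl fun i hi => ?_
      rw [hv i (Finset.mem_insert_of_mem hi), sub_smul]
    have hS : ∀ i ∈ S, v i ∈ W := by
      intro i hi
      have h := ih (fun i => (μ i - μ a) • v i)
        (fun i hi => by rw [map_smul, hv i (Finset.mem_insert_of_mem hi), smul_comm])
        (hμ.mono (by simp)) hstep i hi
      have hne : μ i - μ a ≠ 0 := by
        refine sub_ne_zero.2 fun h => ha ?_
        rwa [← hμ (by simp [hi]) (by simp) h]
      exact (W.smul_mem_iff hne).1 h
    intro i hi
    rcases Finset.mem_insert.1 hi with rfl | hi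
    · rw [Finset.sum_insert ha] at hsum
      exact (W.add_mem_iff_left (W.sum_mem hS)).1 hsum
    · exact hS i hi

lemma exp_I_zpow_injective : Function.Injective (fun k : ℤ => Complex.exp Complex.I ^ k) := by
  intro j k h
  simp only [← Complex.exp_int_mul] at h
  obtain ⟨n, hn⟩ := Complex.exp_eq_exp_iff_exists_int.1 h
  have h1 : (j : ℂ) = k + n * (2 * Real.pi) := by
    apply mul_right_cancel₀ Complex.I_ne_zero
    rw [hn]
    ring
  have h2 : (j : ℝ) = k + n * (2 * Real.pi) := by exact_mod_cast h1
  by_cases h0 : n = 0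
  · subst h0
    simpa using h2
  · exfalso
    refine irrational_pi ⟨(j - k) / (2 * n), ?_⟩
    have : (n : ℝ) ≠ 0 := by exact_mod_cast h0
    push_cast
    field_simp
    linarith

lemma exp_I_pow_injective : Function.Injective (fun k : ℕ => Complex.exp Complex.I ^ k) := by
  intro j k h
  exact_mod_cast exp_I_zpow_injective (a₁ := j) (a₂ := k) (by simpa using h)

/-! ### Homogeneous polynomials -/

/-- The monomial `z₁^a z₂^b` as a function on `ℂ²`. -/
def monomialFun (a b : ℕ) (z : C2) : ℂ := z 0 ^ a * z 1 ^ b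

/-- The homogeneous polynomial functions of degree `n`. -/
def homogeneousFun (n : ℕ) : Submodule ℂ (C2 → ℂ) :=
  Submodule.span ℂ {u | ∃ a b : ℕ, a + b = n ∧ u = monomialFun a b}

lemma monomialFun_mem (a b : ℕ) : monomialFun a b ∈ homogeneousFun (a + b) :=
  Submodule.subset_span ⟨a, b, rfl, rfl⟩

lemma mul_mem_homogeneousFun {m n : ℕ} {u v : C2 → ℂ} (hu : u ∈ homogeneousFun m)
    (hv : v ∈ homogeneousFun n) : u * v ∈ homogeneousFun (m + n) := by
  have h := Submodule.mul_mem_mul hu hv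
  rw [homogeneousFun, homogeneousFun, Submodule.span_mul_span] at h
  refine Submodule.span_mono ?_ h
  rintro _ ⟨_, ⟨a, b, rfl, rfl⟩, _, ⟨c, d, rfl, rfl⟩, rfl⟩
  refine ⟨a + c, b + d, by omega, ?_⟩
  funext z
  simp only [monomialFun, Pi.mul_apply]
  ring

lemma pow_mem_homogeneousFun {u : C2 → ℂ} (hu : u ∈ homogeneousFun 1) (n : ℕ) :
    u ^ n ∈ homogeneousFun n := by
  induction n with
  | zero => exact Submodule.subset_span ⟨0, 0, rfl, by funext z; simp [monomialFun]⟩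
  | succ n ih => exact pow_succ u n ▸ mul_mem_homogeneousFun ih hu

lemma mulVec_apply_mem_homogeneousFun (U : Matrix (Fin 2) (Fin 2) ℂ) (i : Fin 2) :
    (fun z => (U *ᵥ z) i) ∈ homogeneousFun 1 := by
  have h : (fun z : C2 => (U *ᵥ z) i) = U i 0 • monomialFun 1 0 + U i 1 • monomialFun 0 1 := by
    funext z
    simp only [monomialFun, mulVec, dotProduct, Fin.sum_univ_two, Pi.add_apply, Pi.smul_apply,
      smul_eq_mul]
    ring
  rw [h]
  exact add_mem (Submodule.smul_mem _ _ (monomialFun_mem 1 0))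
    (Submodule.smul_mem _ _ (monomialFun_mem 0 1))

lemma monomialFun_mulVec_mem (U : Matrix (Fin 2) (Fin 2) ℂ) (a b : ℕ) :
    (fun z => monomialFun a b (U *ᵥ z)) ∈ homogeneousFun (a + b) :=
  mul_mem_homogeneousFun (pow_mem_homogeneousFun (mulVec_apply_mem_homogeneousFun U 0) a)
    (pow_mem_homogeneousFun (mulVec_apply_mem_homogeneousFun U 1) b)

lemma exists_sum_of_mem_span_antidiagonal {E : Type*} [AddCommGroup E] [Module ℂ E] {n : ℕ}
    {v : ℕ → ℕ → E} {x : E} (hx : x ∈ Submodule.span ℂ {y | ∃ a b : ℕ, a + b = n ∧ y = v a b}) :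
    ∃ c : ℕ × ℕ → ℂ, x = ∑ p ∈ Finset.HasAntidiagonal.antidiagonal n, c p • v p.1 p.2 := by
  have h : {y | ∃ a b : ℕ, a + b = n ∧ y = v a b} =
      (fun p : ℕ × ℕ => v p.1 p.2) '' (Finset.HasAntidiagonal.antidiagonal n : Set (ℕ × ℕ)) := by
    ext y
    simp [eq_comm]
  rw [h, Submodule.mem_span_image_finset_iff_exists_fun] at hx
  obtain ⟨c, hc⟩ := hx
  refine ⟨fun p => if hp : p ∈ Finset.HasAntidiagonal.antidiagonal n then c ⟨p, hp⟩ else 0, ?_⟩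
  rw [← hc, ← Finset.sum_attach (Finset.HasAntidiagonal.antidiagonal n)]
  refine Finset.sum_congr rfl fun p _ => ?_
  simp only [dif_pos p.2]

/-! ### The multiplets -/

/-- The form `u / (F s^{n+2} f^{ℓ/2}) (z₁ dz̄₁ + z₂ dz̄₂)`. -/
noncomputable def homForm (κ : ℝ) (ℓ : ℤ) (n : ℕ) : (C2 → ℂ) →ₗ[ℂ] SpinorField where
  toFun u := radialForm fun z =>
    u z / ((F κ z * s z ^ (n + 2) * f κ z ^ ((ℓ : ℝ) / 2) : ℝ) : ℂ)
  map_add' u v := by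
    rw [← map_add]
    congr 1
    funext z
    simp [add_div]
  map_smul' c u := by
    rw [RingHom.id_apply, ← map_smul]
    congr 1
    funext z
    simp [mul_div_assoc]

lemma homForm_apply (κ : ℝ) (ℓ : ℤ) (n : ℕ) (u : C2 → ℂ) : homForm κ ℓ n u =
    radialForm fun z => u z / ((F κ z * s z ^ (n + 2) * f κ z ^ ((ℓ : ℝ) / 2) : ℝ) : ℂ) := rfl

lemma mode_eq_homForm (κ : ℝ) (ℓ : ℤ) (a b : ℕ) :
    mode κ ℓ a b = homForm κ ℓ (a + b) (monomialFun a b) := rfl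

lemma multiplet_eq_map (κ : ℝ) (ℓ : ℤ) (n : ℕ) :
    multiplet κ ℓ n = (homogeneousFun n).map (homForm κ ℓ n) := by
  rw [multiplet, homogeneousFun, Submodule.map_span]
  congr 1
  ext σ
  constructor
  · rintro ⟨a, b, rfl, rfl⟩
    exact ⟨_, ⟨a, b, rfl, rfl⟩, rfl⟩
  · rintro ⟨_, ⟨a, b, rfl, rfl⟩, rfl⟩
    exact ⟨a, b, rfl, rfl⟩

lemma mode_mem_multiplet (κ : ℝ) (ℓ : ℤ) {a b n : ℕ} (h : a + b = n) :
    mode κ ℓ a b ∈ multiplet κ ℓ n :=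
  Submodule.subset_span ⟨a, b, h, rfl⟩

lemma pullback_homForm (κ : ℝ) (ℓ : ℤ) (n : ℕ) {U : Matrix (Fin 2) (Fin 2) ℂ} (hU : Uᴴ * U = 1)
    (u : C2 → ℂ) : pullback U (homForm κ ℓ n u) = homForm κ ℓ n (fun z => u (U *ᵥ z)) := by
  rw [homForm_apply, pullback_radialForm hU]
  simp only [F_mulVec κ hU, s_mulVec hU, f_mulVec κ hU]
  rfl

lemma conjTranspose_mul_self_of_mem {U : Matrix (Fin 2) (Fin 2) ℂ}
    (hU : U ∈ specialUnitaryGroup (Fin 2) ℂ) : Uᴴ * U = 1 :=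
  mem_unitaryGroup_iff'.1 (mem_specialUnitaryGroup_iff.1 hU).1

lemma pullback_mode_mem (κ : ℝ) (ℓ : ℤ) {U : Matrix (Fin 2) (Fin 2) ℂ} (hU : Uᴴ * U = 1)
    (a b : ℕ) : pullback U (mode κ ℓ a b) ∈ multiplet κ ℓ (a + b) := by
  rw [mode_eq_homForm, pullback_homForm κ ℓ _ hU, multiplet_eq_map]
  exact Submodule.mem_map_of_mem (monomialFun_mulVec_mem U a b)

lemma pullback_mem_multiplet (κ : ℝ) (ℓ : ℤ) (n : ℕ) {U : Matrix (Fin 2) (Fin 2) ℂ}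
    (hU : Uᴴ * U = 1) {σ : SpinorField} (hσ : σ ∈ multiplet κ ℓ n) :
    pullback U σ ∈ multiplet κ ℓ n := by
  suffices multiplet κ ℓ n ≤ (multiplet κ ℓ n).comap (pullbackLinear U) from this hσ
  refine Submodule.span_le.2 ?_
  rintro _ ⟨a, b, rfl, rfl⟩
  exact pullback_mode_mem κ ℓ hU a b

lemma isSU2Invariant_multiplet (κ : ℝ) (ℓ : ℤ) (n : ℕ) : IsSU2Invariant (multiplet κ ℓ n) :=
  fun _ hU _ hσ => pullback_mem_multiplet κ ℓ n (conjTranspose_mul_self_of_mem hU) hσ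

/-- Components of elements of a subspace of a multiplet invariant under the maximal torus. -/
lemma mode_mem_of_sum_mem (κ : ℝ) (ℓ : ℤ) {n : ℕ} {W : Submodule ℂ SpinorField}
    (hW : IsSU2Invariant W) {c : ℕ × ℕ → ℂ}
    (hc : ∑ p ∈ Finset.HasAntidiagonal.antidiagonal n, c p • mode κ ℓ p.1 p.2 ∈ W) {p : ℕ × ℕ}
    (hp : p.1 + p.2 = n) (hcp : c p ≠ 0) : mode κ ℓ p.1 p.2 ∈ W := by
  have hconj : (starRingEnd ℂ) (Complex.exp Complex.I) = Complex.exp (-Complex.I) := by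
    rw [← Complex.exp_conj, Complex.conj_I]
  have hconj' : (starRingEnd ℂ) (Complex.exp (-Complex.I)) = Complex.exp Complex.I := by
    rw [← hconj, Complex.conj_conj]
  have hmul : Complex.exp Complex.I * Complex.exp (-Complex.I) = 1 := by
    rw [← Complex.exp_add, add_neg_cancel, Complex.exp_zero]
  have hmul' : Complex.exp (-Complex.I) * Complex.exp Complex.I = 1 := by rw [mul_comm, hmul]
  have hU : diagonal ![Complex.exp Complex.I, Complex.exp (-Complex.I)] ∈
      specialUnitaryGroup (Fin 2) ℂ := by
    refine mem_specialUnitaryGroup_iff.2 ⟨mem_unitaryGroup_iff'.2 ?_, ?_⟩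
    · rw [star_eq_conjTranspose, diagonal_conjTranspose, diagonal_mul_diagonal, ← diagonal_one]
      congr 1
      funext i
      fin_cases i
      · simp [hconj, hmul']
      · simp [hconj', hmul]
    · simp [det_diagonal, Fin.prod_univ_two, hmul]
  have hT := fun x hx => hW _ hU x hx
  have key := mem_of_sum_mem_of_eigenvectors (pullbackLinear _) W hT
    (fun p : ℕ × ℕ => Complex.exp Complex.I ^ ((p.1 : ℤ) - p.2)) (Finset.HasAntidiagonal.antidiagonal n)
    (fun p => c p • mode κ ℓ p.1 p.2) ?_ ?_ hc p (by simpa using hp)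
  · exact (W.smul_mem_iff hcp).1 key
  · intro q hq
    have hu : (fun z => monomialFun q.1 q.2
        (diagonal ![Complex.exp Complex.I, Complex.exp (-Complex.I)] *ᵥ z)) =
        Complex.exp Complex.I ^ ((q.1 : ℤ) - q.2) • monomialFun q.1 q.2 := by
      funext z
      simp only [monomialFun, mulVec_diagonal, Pi.smul_apply, smul_eq_mul, cons_val_zero,
        cons_val_one]
      rw [zpow_sub₀ (Complex.exp_ne_zero _), Complex.exp_neg, mul_pow, mul_pow]
      simp only [zpow_natCast, inv_pow]
      ring
    rw [map_smul, pullbackLinear_apply, mode_eq_homForm,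
      pullback_homForm κ ℓ _ (conjTranspose_mul_self_of_mem hU), hu, map_smul, smul_comm]
  · intro q hq r hr h
    have h := exp_I_zpow_injective h
    simp only [Finset.mem_coe, Finset.HasAntidiagonal.mem_antidiagonal] at hq hr
    ext <;> omega

lemma rotation_mem : !![(3 / 5 : ℂ), -(4 / 5); 4 / 5, 3 / 5] ∈ specialUnitaryGroup (Fin 2) ℂ := by
  refine mem_specialUnitaryGroup_iff.2 ⟨mem_unitaryGroup_iff'.2 ?_, ?_⟩
  · ext i j
    fin_cases i <;> fin_cases j <;>
      simp [star_eq_conjTranspose, Matrix.mul_apply, Fin.sum_univ_two, Complex.conj_ofNat] <;>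
      norm_num
  · rw [det_fin_two_of]
    norm_num

lemma multiplet_irreducible (κ : ℝ) (ℓ : ℤ) (n : ℕ) {W : Submodule ℂ SpinorField}
    (hle : W ≤ multiplet κ ℓ n) (hW : IsSU2Invariant W) : W = ⊥ ∨ W = multiplet κ ℓ n := by
  refine or_iff_not_imp_left.2 fun hne => le_antisymm hle ?_
  obtain ⟨σ, hσ, hσ0⟩ := W.ne_bot_iff.1 hne
  obtain ⟨c, rfl⟩ := exists_sum_of_mem_span_antidiagonal (hle hσ)
  obtain ⟨p, hp, hp0⟩ := Finset.exists_ne_zero_of_sum_ne_zero hσ0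
  have hpn : p.1 + p.2 = n := by simpa using hp
  have hpW := mode_mem_of_sum_mem κ ℓ hW hσ hpn fun h => hp0 (by simp [h])
  have hR := conjTranspose_mul_self_of_mem rotation_mem
  have hn0 : mode κ ℓ n 0 ∈ W := by
    have h1 := hW _ rotation_mem _ hpW
    have h2 := monomialFun_mulVec_mem !![(3 / 5 : ℂ), -(4 / 5); 4 / 5, 3 / 5] p.1 p.2
    rw [mode_eq_homForm, pullback_homForm κ ℓ _ hR] at h1
    obtain ⟨k, hk⟩ := exists_sum_of_mem_span_antidiagonal h2
    rw [hk, map_sum] at h1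
    have hk0 : k (n, 0) ≠ 0 := by
      have h3 := congrFun hk ![1, 0]
      rw [Finset.sum_apply, Finset.sum_eq_single (n, 0)] at h3
      · simp [monomialFun] at h3
        rw [← h3]
        exact mul_ne_zero (pow_ne_zero _ (by norm_num)) (pow_ne_zero _ (by norm_num))
      · intro q hq hqn
        have : q.2 ≠ 0 := by
          intro h0
          rw [Finset.HasAntidiagonal.mem_antidiagonal, hpn] at hq
          exact hqn (by ext <;> simp <;> omega)
        simp [monomialFun, this]
      · simp [hpn]
    refine mode_mem_of_sum_mem κ ℓ hW (c := k) (p := (n, 0)) (n := n) ?_ (by simp) hk0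
    rw [hpn] at h1
    convert h1 using 1
    refine Finset.sum_congr rfl fun q hq => ?_
    rw [map_smul, mode_eq_homForm, Finset.HasAntidiagonal.mem_antidiagonal.1 hq]
  have hall : ∀ p : ℕ × ℕ, p.1 + p.2 = n → mode κ ℓ p.1 p.2 ∈ W := by
    intro p hp
    refine mode_mem_of_sum_mem κ ℓ hW
      (c := fun q => n.choose q.1 * (3 / 5) ^ q.1 * (-(4 / 5)) ^ q.2) ?_ hp ?_
    · have h1 := hW _ rotation_mem _ hn0
      rw [mode_eq_homForm, pullback_homForm κ ℓ _ hR] at h1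
      have h2 : (fun z => monomialFun n 0 (!![(3 / 5 : ℂ), -(4 / 5); 4 / 5, 3 / 5] *ᵥ z)) =
          ∑ q ∈ Finset.HasAntidiagonal.antidiagonal n,
            (n.choose q.1 * (3 / 5 : ℂ) ^ q.1 * (-(4 / 5)) ^ q.2) • monomialFun q.1 q.2 := by
        funext z
        have h3 : (!![(3 / 5 : ℂ), -(4 / 5); 4 / 5, 3 / 5] *ᵥ z) 0 =
            3 / 5 * z 0 + -(4 / 5) * z 1 := by
          simp [mulVec, dotProduct, Fin.sum_univ_two]
        rw [monomialFun, h3, pow_zero, mul_one, (Commute.all _ _).add_pow', Finset.sum_apply]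
        refine Finset.sum_congr rfl fun q hq => ?_
        simp only [monomialFun, Pi.smul_apply, smul_eq_mul, nsmul_eq_mul, mul_pow]
        ring
      rw [h2, map_sum] at h1
      convert h1 using 1
      refine Finset.sum_congr rfl fun q hq => ?_
      rw [map_smul, mode_eq_homForm, Finset.HasAntidiagonal.mem_antidiagonal.1 hq, add_zero]
    · have : n.choose p.1 ≠ 0 := (Nat.choose_pos (by omega)).ne'
      have : (n.choose p.1 : ℂ) ≠ 0 := by exact_mod_cast this
      exact mul_ne_zero (mul_ne_zero this (pow_ne_zero _ (by norm_num)))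
        (pow_ne_zero _ (by norm_num))
  refine Submodule.span_le.2 ?_
  rintro _ ⟨a, b, hab, rfl⟩
  exact hall (a, b) hab

/-! ### Linear independence and dimensions -/

lemma modeCoeff_circle (κ : ℝ) (ℓ : ℤ) (a b : ℕ) (t : Circle × Circle) :
    modeCoeff κ ℓ a b ![(t.1 : ℂ), (t.2 : ℂ)] =
      (t.1 : ℂ) ^ a * (t.2 : ℂ) ^ b * (((F κ ![1, 1] * s ![1, 1] ^ (a + b + 2) *
        f κ ![1, 1] ^ ((ℓ : ℝ) / 2) : ℝ) : ℂ))⁻¹ := by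
  have h : s ![(t.1 : ℂ), (t.2 : ℂ)] = s ![1, 1] := by simp [s]
  simp only [modeCoeff, F, f, h, cons_val_zero, cons_val_one, div_eq_mul_inv]

lemma linearIndependent_mode {κ : ℝ} (hκ : 0 < κ) (ℓ : ℤ) :
    LinearIndependent ℂ (fun p : ℕ × ℕ => mode κ ℓ p.1 p.2) := by
  let L : SpinorField →ₗ[ℂ] (Circle × Circle → ℂ) :=
    { toFun := fun σ t => (σ ![(t.1 : ℂ), (t.2 : ℂ)]).2.1 0 * (t.1 : ℂ)⁻¹
      map_add' := fun σ τ => by funext t; simp [add_mul]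
      map_smul' := fun c σ => by funext t; simp [mul_assoc] }
  let χ : ℕ × ℕ → (Circle × Circle →* ℂ) := fun p =>
    (Circle.coeHom.comp (MonoidHom.fst _ _)) ^ p.1 * (Circle.coeHom.comp (MonoidHom.snd _ _)) ^ p.2
  have hχ : ∀ p t, χ p t = (t.1 : ℂ) ^ p.1 * (t.2 : ℂ) ^ p.2 := fun p t => rfl
  have hinj : Function.Injective χ := by
    intro p q h
    have h1 := DFunLike.congr_fun h (Circle.exp 1, 1)
    have h2 := DFunLike.congr_fun h (1, Circle.exp 1)
    simp only [hχ, Circle.coe_one, one_pow, mul_one, one_mul, Circle.coe_exp, Complex.ofReal_one]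
      at h1 h2
    exact Prod.ext (exp_I_pow_injective h1) (exp_I_pow_injective h2)
  have hs : (0 : ℝ) < s ![1, 1] := s_pos fun h => one_ne_zero (congrFun h 0)
  have hpos : ∀ p : ℕ × ℕ, ((F κ ![1, 1] * s ![1, 1] ^ (p.1 + p.2 + 2) *
      f κ ![1, 1] ^ ((ℓ : ℝ) / 2) : ℝ) : ℂ) ≠ 0 := by
    intro p
    have := F_pos hκ ![1, 1]
    have := f_pos hκ ![1, 1]
    exact_mod_cast (by positivity : (0 : ℝ) < _).ne'
  refine LinearIndependent.of_comp L ?_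
  have hlin := ((linearIndependent_monoidHom (Circle × Circle) ℂ).comp χ hinj).units_smul
    fun p => (Units.mk0 _ (hpos p))⁻¹
  have heq : (L ∘ fun p : ℕ × ℕ => mode κ ℓ p.1 p.2) =
      (fun p => (Units.mk0 _ (hpos p))⁻¹) • ((fun g : Circle × Circle →* ℂ => (g : _ → ℂ)) ∘ χ) := by
    funext p t
    simp only [Function.comp_apply, Pi.smul_apply', Pi.smul_apply, hχ, Units.smul_def,
      Units.val_inv_eq_inv_val, Units.val_mk0, smul_eq_mul]
    change modeCoeff κ ℓ p.1 p.2 ![(t.1 : ℂ), (t.2 : ℂ)] * (t.1 : ℂ) * (t.1 : ℂ)⁻¹ = _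
    rw [modeCoeff_circle, mul_assoc _ (t.1 : ℂ), mul_inv_cancel₀ t.1.coe_ne_zero, mul_one, mul_comm]
  rw [heq]
  exact hlin

lemma finrank_span_mode {κ : ℝ} (hκ : 0 < κ) (ℓ : ℤ) (S : Finset (ℕ × ℕ)) :
    Module.finrank ℂ (Submodule.span ℂ ((fun p : ℕ × ℕ => mode κ ℓ p.1 p.2) '' S)) = S.card := by
  have h := finrank_span_eq_card ((linearIndependent_mode hκ ℓ).comp
    (fun p : S => (p : ℕ × ℕ)) Subtype.val_injective)
  rw [Fintype.card_coe] at h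
  have hr : Set.range (fun p : S => (p : ℕ × ℕ)) = S := Subtype.range_coe
  rw [← h, Set.range_comp (fun p : ℕ × ℕ => mode κ ℓ p.1 p.2), hr]

lemma multiplet_eq_span_image (κ : ℝ) (ℓ : ℤ) (n : ℕ) : multiplet κ ℓ n =
    Submodule.span ℂ ((fun p : ℕ × ℕ => mode κ ℓ p.1 p.2) '' (Finset.HasAntidiagonal.antidiagonal n)) := by
  rw [multiplet]
  congr 1
  ext σ
  simp [eq_comm]

lemma finrank_multiplet {κ : ℝ} (hκ : 0 < κ) (ℓ : ℤ) (n : ℕ) :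
    Module.finrank ℂ (multiplet κ ℓ n) = n + 1 := by
  rw [multiplet_eq_span_image, finrank_span_mode hκ, Finset.Nat.card_antidiagonal]

lemma iSup_multiplet_eq_span (κ : ℝ) (ℓ : ℤ) :
    (⨆ n : ℕ, ⨆ _ : (n : ℤ) + 1 ≤ ℓ, multiplet κ ℓ n) =
      Submodule.span ℂ ((fun p : ℕ × ℕ => mode κ ℓ p.1 p.2) ''
        ((Finset.range ℓ.toNat).biUnion Finset.HasAntidiagonal.antidiagonal : Finset (ℕ × ℕ))) := by
  refine le_antisymm (iSup₂_le fun n hn => ?_) (Submodule.span_le.2 ?_)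
  · rw [multiplet_eq_span_image]
    refine Submodule.span_mono (Set.image_mono ?_)
    intro p hp
    simp only [Finset.coe_biUnion, Set.mem_iUnion]
    exact ⟨n, by simp; omega, hp⟩
  · rintro _ ⟨p, hp, rfl⟩
    simp only [Finset.coe_biUnion, Set.mem_iUnion, Finset.coe_range, Set.mem_Iio] at hp
    obtain ⟨n, hn, hp⟩ := hp
    exact Submodule.mem_iSup_of_mem n (Submodule.mem_iSup_of_mem (by omega)
      (mode_mem_multiplet κ ℓ (by simpa using hp)))

lemma finrank_iSup_multiplet {κ : ℝ} (hκ : 0 < κ) {ℓ : ℤ} (hℓ : 0 ≤ ℓ) :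
    2 * (Module.finrank ℂ (⨆ n : ℕ, ⨆ _ : (n : ℤ) + 1 ≤ ℓ, multiplet κ ℓ n :
      Submodule ℂ SpinorField) : ℤ) = ℓ * (ℓ + 1) := by
  rw [iSup_multiplet_eq_span, finrank_span_mode hκ, Finset.card_biUnion]
  · simp only [Finset.Nat.card_antidiagonal]
    lift ℓ to ℕ using hℓ
    rw [Int.toNat_natCast]
    induction ℓ with
    | zero => simp
    | succ n ih =>
      rw [Finset.sum_range_succ]
      push_cast at ih ⊢
      linarith
  · intro m _ n _ hmn
    refine Finset.disjoint_left.2 fun p hp hp' => hmn ?_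
    rw [Finset.HasAntidiagonal.mem_antidiagonal] at hp hp'
    omega

/-! ### Wirtinger calculus -/

lemma dzbar_eq_of_hasFDerivAt {u : C2 → ℂ} {u' : C2 →L[ℝ] ℂ} {z : C2} (h : HasFDerivAt u u' z)
    (i : Fin 2) :
    dzbar i u z = (u' (Pi.single i 1) + Complex.I * u' (Pi.single i Complex.I)) / 2 := by
  rw [dzbar, h.fderiv]

lemma dzbar_const (i : Fin 2) (c : ℂ) (z : C2) : dzbar i (fun _ => c) z = 0 := by
  rw [dzbar_eq_of_hasFDerivAt (hasFDerivAt_const c z)]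
  simp

lemma dzbar_add {u v : C2 → ℂ} {z : C2} (hu : DifferentiableAt ℝ u z) (hv : DifferentiableAt ℝ v z)
    (i : Fin 2) : dzbar i (fun y => u y + v y) z = dzbar i u z + dzbar i v z := by
  rw [dzbar_eq_of_hasFDerivAt (u := fun y => u y + v y) (hu.hasFDerivAt.add hv.hasFDerivAt), dzbar, dzbar]
  simp only [_root_.add_apply]
  ring

lemma dzbar_mul {u v : C2 → ℂ} {z : C2} (hu : DifferentiableAt ℝ u z) (hv : DifferentiableAt ℝ v z)
    (i : Fin 2) : dzbar i (fun y => u y * v y) z = u z * dzbar i v z + dzbar i u z * v z := by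
  rw [dzbar_eq_of_hasFDerivAt (u := fun y => u y * v y) (hu.hasFDerivAt.mul hv.hasFDerivAt), dzbar, dzbar]
  simp only [_root_.add_apply, _root_.smul_apply, smul_eq_mul]
  ring

lemma dzbar_const_mul {u : C2 → ℂ} {z : C2} (hu : DifferentiableAt ℝ u z) (c : ℂ)
    (i : Fin 2) : dzbar i (fun y => c * u y) z = c * dzbar i u z := by
  rw [dzbar_mul (differentiableAt_const c) hu, dzbar_const, zero_mul, add_zero]

lemma differentiable_coord (j : Fin 2) : Differentiable ℝ fun y : C2 => y j := by
  fun_prop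

lemma differentiable_star_coord (j : Fin 2) : Differentiable ℝ fun y : C2 => star (y j) :=
  (differentiable_coord j).star

lemma dzbar_coord (i j : Fin 2) (z : C2) : dzbar i (fun y => y j) z = 0 := by
  rw [dzbar_eq_of_hasFDerivAt (u := fun y : C2 => y j)
    (ContinuousLinearMap.proj (R := ℝ) (φ := fun _ : Fin 2 => ℂ) j).hasFDerivAt]
  by_cases h : j = i
  · subst h
    simp
  · simp [h]

lemma dzbar_star_coord (i j : Fin 2) (z : C2) :
    dzbar i (fun y => star (y j)) z = if i = j then 1 else 0 := by
  rw [dzbar_eq_of_hasFDerivAt (u := fun y : C2 => star (y j))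
    (ContinuousLinearMap.proj (R := ℝ) (φ := fun _ : Fin 2 => ℂ) j).hasFDerivAt.star]
  by_cases h : i = j
  · subst h
    simp
  · simp [h, Ne.symm h]

lemma dzbar_pow {u : C2 → ℂ} {z : C2} (hu : DifferentiableAt ℝ u z) (i : Fin 2) (k : ℕ) :
    dzbar i (fun y => u y ^ k) z = k * u z ^ (k - 1) * dzbar i u z := by
  rw [dzbar_eq_of_hasFDerivAt (u := fun y => u y ^ k) (hu.hasFDerivAt.pow k), dzbar]
  simp
  ring

lemma contDiff_s : ContDiff ℝ ∞ s := by
  have h : s = fun z => (z 0).re ^ 2 + (z 0).im ^ 2 + ((z 1).re ^ 2 + (z 1).im ^ 2) := by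
    funext z
    simp only [s, Complex.normSq_apply]
    ring
  rw [h]
  have hre : ∀ j, ContDiff ℝ ∞ fun z : C2 => (z j).re := fun j =>
    Complex.reCLM.contDiff.comp (contDiff_apply ℝ ℂ j)
  have him : ∀ j, ContDiff ℝ ∞ fun z : C2 => (z j).im := fun j =>
    Complex.imCLM.contDiff.comp (contDiff_apply ℝ ℂ j)
  exact (((hre 0).pow 2).add ((him 0).pow 2)).add (((hre 1).pow 2).add ((him 1).pow 2))

lemma differentiable_s : Differentiable ℝ s := contDiff_s.differentiable (by simp)

lemma dzbar_s (i : Fin 2) (z : C2) : dzbar i (fun y => (s y : ℂ)) z = z i := by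
  have h := fun j => differentiable_coord j z
  have h' := fun j => differentiable_star_coord j z
  simp only [ofReal_s]
  rw [dzbar_add ((h 0).fun_mul (h' 0)) ((h 1).fun_mul (h' 1)), dzbar_mul (h 0) (h' 0),
    dzbar_mul (h 1) (h' 1)]
  simp only [dzbar_coord, dzbar_star_coord]
  fin_cases i <;> simp

lemma differentiableAt_radial {q : ℝ → ℝ} {q' : ℝ} {z : C2} (hq : HasDerivAt q q' (s z)) :
    DifferentiableAt ℝ (fun y => (q (s y) : ℂ)) z :=
  (Complex.ofRealCLM.hasFDerivAt.comp z
    (hq.comp_hasFDerivAt z (differentiable_s z).hasFDerivAt)).differentiableAt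

lemma dzbar_radial {q : ℝ → ℝ} {q' : ℝ} {z : C2} (hq : HasDerivAt q q' (s z)) (i : Fin 2) :
    dzbar i (fun y => (q (s y) : ℂ)) z = q' * z i := by
  have h1 := dzbar_eq_of_hasFDerivAt (Complex.ofRealCLM.hasFDerivAt.comp z
    (hq.comp_hasFDerivAt z (differentiable_s z).hasFDerivAt)) i
  have h2 := dzbar_eq_of_hasFDerivAt (Complex.ofRealCLM.hasFDerivAt.comp z
    (differentiable_s z).hasFDerivAt) i
  have h3 := dzbar_s i z
  change dzbar i (Complex.ofRealCLM ∘ s) z = _ at h3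
  change dzbar i (Complex.ofRealCLM ∘ (q ∘ s)) z = _
  rw [h1, ← h3, h2]
  simp
  ring

/-! ### Smoothness -/

lemma contDiffOn_F {κ : ℝ} (hκ : 0 < κ) : ContDiffOn ℝ ∞ (F κ) {0}ᶜ := by
  refine ContDiffOn.sqrt (contDiffOn_const.add (contDiffOn_const.div
    (contDiff_s.contDiffOn.pow 2) fun z hz => ?_)) fun z _ => ?_
  · exact pow_ne_zero 2 (s_pos hz).ne'
  · positivity

lemma contDiffOn_f {κ : ℝ} (hκ : 0 < κ) : ContDiffOn ℝ ∞ (f κ) {0}ᶜ :=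
  (contDiffOn_F hκ).add (contDiffOn_const.div contDiff_s.contDiffOn fun _ hz => (s_pos hz).ne')

lemma contDiff_monomialFun (a b : ℕ) : ContDiff ℝ ∞ (monomialFun a b) :=
  ((contDiff_apply ℝ ℂ 0).pow a).mul ((contDiff_apply ℝ ℂ 1).pow b)

lemma contDiffOn_ofReal {u : C2 → ℝ} {S : Set C2} (h : ContDiffOn ℝ ∞ u S) :
    ContDiffOn ℝ ∞ (fun z => (u z : ℂ)) S :=
  Complex.ofRealCLM.contDiff.comp_contDiffOn h

lemma contDiffOn_star {u : C2 → ℂ} {S : Set C2} (h : ContDiffOn ℝ ∞ u S) :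
    ContDiffOn ℝ ∞ (fun z => star (u z)) S :=
  Complex.conjCLE.contDiff.comp_contDiffOn h

lemma contDiffOn_modeCoeff {κ : ℝ} (hκ : 0 < κ) (ℓ : ℤ) (a b : ℕ) :
    ContDiffOn ℝ ∞ (modeCoeff κ ℓ a b) {0}ᶜ := by
  have hden := contDiffOn_ofReal (((contDiffOn_F hκ).mul
    (contDiff_s.contDiffOn.pow (a + b + 2))).mul ((contDiffOn_f hκ).rpow_const_of_ne
      (p := (ℓ : ℝ) / 2) fun z _ => (f_pos hκ z).ne'))
  have e : modeCoeff κ ℓ a b = fun z => monomialFun a b z *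
      ((F κ z * s z ^ (a + b + 2) * f κ z ^ ((ℓ : ℝ) / 2) : ℝ) : ℂ)⁻¹ := rfl
  rw [e]
  refine (contDiff_monomialFun a b).contDiffOn.mul (hden.inv fun z hz => ?_)
  have := F_pos hκ z
  have := f_pos hκ z
  have := s_pos hz
  exact_mod_cast (by positivity : (0 : ℝ) < _).ne'

lemma contDiffOn_radialForm {h : C2 → ℂ} (hh : ContDiffOn ℝ ∞ h {0}ᶜ) :
    ContDiffOn ℝ ∞ (radialForm h) {0}ᶜ :=
  contDiffOn_const.prodMk ((hh.smul contDiff_id.contDiffOn).prodMk contDiffOn_const)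

lemma differentiableAt_of_contDiffOn {u : C2 → ℂ} (hu : ContDiffOn ℝ ∞ u {0}ᶜ) {z : C2}
    (hz : z ≠ 0) : DifferentiableAt ℝ u z :=
  (hu.contDiffAt (isOpen_compl_singleton.mem_nhds hz)).differentiableAt (by simp)

/-! ### Integration by parts -/

lemma contDiff_mul_of_zero_notMem_tsupport {φ V : C2 → ℂ} (hφ : ContDiff ℝ ∞ φ)
    (h0 : (0 : C2) ∉ tsupport φ) (hV : ContDiffOn ℝ ∞ V {0}ᶜ) :
    ContDiff ℝ ∞ (fun z => φ z * V z) := by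
  refine contDiff_iff_contDiffAt.2 fun z => ?_
  by_cases hz : z = 0
  · subst hz
    refine (contDiffAt_const (c := (0 : ℂ))).congr_of_eventuallyEq ?_
    filter_upwards [notMem_tsupport_iff_eventuallyEq.1 h0] with y hy
    simp [hy]
  · exact hφ.contDiffAt.mul (hV.contDiffAt (isOpen_compl_singleton.mem_nhds hz))

lemma integrable_fderiv_apply {u : C2 → ℂ} (hu : ContDiff ℝ ∞ u) (hc : HasCompactSupport u)
    (v : C2) : Integrable (fun z => fderiv ℝ u z v) :=
  ((hu.continuous_fderiv (by simp)).clm_apply continuous_const).integrable_of_hasCompactSupport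
    (hc.fderiv_apply ℝ v)

lemma integral_fderiv_apply {u : C2 → ℂ} (hu : ContDiff ℝ ∞ u) (hc : HasCompactSupport u)
    (v : C2) : ∫ z, fderiv ℝ u z v = 0 := by
  have h := integral_mul_fderiv_eq_neg_fderiv_mul_of_integrable (μ := volume)
    (f := fun _ : C2 => (1 : ℂ)) (g := u) (v := v) (by simp)
    (by simpa using integrable_fderiv_apply hu hc v)
    (by simpa using hu.continuous.integrable_of_hasCompactSupport hc)
    (fun _ _ => differentiableAt_const _) (fun x _ => hu.differentiable (by simp) x)
  simpa using h

lemma integrable_dzbar {u : C2 → ℂ} (hu : ContDiff ℝ ∞ u) (hc : HasCompactSupport u)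
    (i : Fin 2) : Integrable (dzbar i u) :=
  ((integrable_fderiv_apply hu hc _).add ((integrable_fderiv_apply hu hc _).const_mul _)).div_const 2

lemma integral_dzbar {u : C2 → ℂ} (hu : ContDiff ℝ ∞ u) (hc : HasCompactSupport u)
    (i : Fin 2) : ∫ z, dzbar i u z = 0 := by
  unfold dzbar
  rw [integral_div, integral_add (integrable_fderiv_apply hu hc _)
    ((integrable_fderiv_apply hu hc _).const_mul _), integral_const_mul,
    integral_fderiv_apply hu hc, integral_fderiv_apply hu hc]
  simp

/-! ### Zero modes of radial type -/

/-- The coefficients `h` for which `h (z₁ dz̄₁ + z₂ dz̄₂)` is `∂̄`-closed and solves the divergence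
equation `∑ ∂ᵢ (F h zᵢ) = (ℓ/2) (√κ/s) h` (written here for the complex conjugate). -/
def radialSolutions (κ : ℝ) (hκ : 0 < κ) (ℓ : ℤ) : Submodule ℂ (C2 → ℂ) where
  carrier := {h | ContDiffOn ℝ ∞ h {0}ᶜ ∧ ∀ z, z ≠ 0 →
    dzbar 0 h z * z 1 = dzbar 1 h z * z 0 ∧
    ∑ i, star (z i) * dzbar i (fun y => F κ y * star (h y)) z + 2 * (F κ z * star (h z)) =
      ℓ / 2 * (√κ / s z : ℝ) * star (h z)}
  zero_mem' := by
    refine ⟨contDiffOn_const, fun z hz => ?_⟩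
    have h0 : (fun y : C2 => (F κ y : ℂ) * star ((0 : C2 → ℂ) y)) = fun _ => 0 := by simp
    have h1 : (0 : C2 → ℂ) = fun _ => 0 := rfl
    rw [h0]
    constructor
    · rw [h1]
      simp [dzbar_const]
    · simp [dzbar_const]
  add_mem' := by
    rintro h k ⟨hh, hh'⟩ ⟨hk, hk'⟩
    refine ⟨hh.add hk, fun z hz => ?_⟩
    obtain ⟨h1, h2⟩ := hh' z hz
    obtain ⟨k1, k2⟩ := hk' z hz
    have hF := contDiffOn_ofReal (contDiffOn_F hκ)
    have e1 : (fun y : C2 => (F κ y : ℂ) * star ((h + k) y)) =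
        fun y => F κ y * star (h y) + F κ y * star (k y) := by
      funext y
      simp [mul_add]
    have e2 : h + k = fun y => h y + k y := rfl
    rw [e1]
    constructor
    · rw [e2]
      simp only [dzbar_add (differentiableAt_of_contDiffOn hh hz)
        (differentiableAt_of_contDiffOn hk hz)]
      linear_combination h1 + k1
    · simp only [dzbar_add (differentiableAt_of_contDiffOn (hF.mul (contDiffOn_star hh)) hz)
        (differentiableAt_of_contDiffOn (hF.mul (contDiffOn_star hk)) hz), Pi.add_apply, star_add]
      simp only [mul_add, Finset.sum_add_distrib] at h2 k2 ⊢
      linear_combination h2 + k2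
  smul_mem' := by
    rintro c h ⟨hh, hh'⟩
    refine ⟨contDiffOn_const.smul hh, fun z hz => ?_⟩
    obtain ⟨h1, h2⟩ := hh' z hz
    have hF := contDiffOn_ofReal (contDiffOn_F hκ)
    have e1 : (fun y : C2 => (F κ y : ℂ) * star ((c • h) y)) =
        fun y => star c * (F κ y * star (h y)) := by
      funext y
      simp
      ring
    have e2 : c • h = fun y => c * h y := rfl
    rw [e1]
    constructor
    · rw [e2]
      simp only [dzbar_const_mul (differentiableAt_of_contDiffOn hh hz)]
      linear_combination c * h1
    · simp only [dzbar_const_mul (differentiableAt_of_contDiffOn (hF.mul (contDiffOn_star hh)) hz),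
        Pi.smul_apply, smul_eq_mul, star_mul']
      simp only [Fin.sum_univ_two] at h2 ⊢
      linear_combination star c * h2

lemma isDbarStar_radialForm {κ : ℝ} {hκ : 0 < κ} {ℓ : ℤ} {h : C2 → ℂ}
    (hh : h ∈ radialSolutions κ hκ ℓ) :
    IsDbarStar κ (radialForm h) (fun z => (-(ℓ / 2 * (√κ / s z : ℝ) * h z), 0, 0)) := by
  obtain ⟨hh, hsol⟩ := hh
  have hF := contDiffOn_ofReal (contDiffOn_F hκ)
  have hτ : ContDiffOn ℝ ∞ (fun z => -((ℓ / 2 : ℂ) * (√κ / s z : ℝ) * h z)) {0}ᶜ :=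
    ((contDiffOn_const.mul (contDiffOn_ofReal (contDiffOn_const.div
      contDiff_s.contDiffOn fun _ hz => (s_pos hz).ne'))).mul hh).neg
  refine ⟨hτ.prodMk contDiffOn_const, ?_⟩
  rintro φ ⟨hφ, hφc, hφ0⟩
  set α : C2 → ℂ := fun z => (φ z).1 with hα_def
  have hα : ContDiff ℝ ∞ α := contDiff_fst.comp hφ
  have hsupp : tsupport α ⊆ tsupport φ :=
    closure_mono fun z hz hz' => hz (by simp [hα_def, hz'])
  have hαc : HasCompactSupport α := hφc.of_isClosed_subset (isClosed_tsupport _) hsupp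
  have hα0 : (0 : C2) ∉ tsupport α := fun h0 => hφ0 (hsupp h0)
  have hFh := hF.mul (contDiffOn_star hh)
  have hV : ∀ i, ContDiffOn ℝ ∞ (fun z : C2 => (F κ z : ℂ) * star (h z) * star (z i)) {0}ᶜ :=
    fun i => hFh.mul (contDiffOn_star (contDiff_apply ℝ ℂ i).contDiffOn)
  have hu := fun i => contDiff_mul_of_zero_notMem_tsupport hα hα0 (hV i)
  have huc : ∀ i, HasCompactSupport fun z : C2 => α z * (F κ z * star (h z) * star (z i)) :=
    fun i => hαc.mul_right
  have hR : Integrable fun z => α z * star (-((ℓ / 2 : ℂ) * (√κ / s z : ℝ) * h z)) :=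
    (contDiff_mul_of_zero_notMem_tsupport hα hα0
      (contDiffOn_star hτ)).continuous.integrable_of_hasCompactSupport hαc.mul_right
  have hne : ∀ᵐ z : C2, z ≠ 0 := by simp [ae_iff]
  have hleft : (fun z => herm κ z (dbar φ z) (radialForm h z) * (volDensity κ z : ℂ)) =ᵐ[volume]
      fun z => α z * star (-((ℓ / 2 : ℂ) * (√κ / s z : ℝ) * h z)) +
        ∑ i, dzbar i (fun z : C2 => α z * (F κ z * star (h z) * star (z i))) z := by
    filter_upwards [hne] with z hz
    have hsz := (hsol z hz).2
    have hdα := hα.differentiable (by simp) z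
    have hdF := differentiableAt_of_contDiffOn hFh hz
    have hdV := fun i => differentiableAt_of_contDiffOn (hV i) hz
    have hdst := fun i => differentiable_star_coord i z
    rw [herm_radialForm_right hκ hz, volDensity_eq_one hκ hz]
    simp only [dbar, dotProduct, Fin.sum_univ_two, Pi.star_apply, dzbar_mul hdα (hdV _),
      dzbar_mul hdF (hdst _), dzbar_star_coord, if_true] at hsz ⊢
    simp only [star_neg, star_mul', star_div₀, Complex.star_def, Complex.conj_ofReal, map_ofNat,
      map_intCast, Complex.ofReal_one] at hsz ⊢
    linear_combination (-α z) * hsz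
  have hright : (fun z => herm κ z (φ z) (-(ℓ / 2 * (√κ / s z : ℝ) * h z), 0, 0) *
      (volDensity κ z : ℂ)) =ᵐ[volume]
      fun z => α z * star (-((ℓ / 2 : ℂ) * (√κ / s z : ℝ) * h z)) := by
    filter_upwards [hne] with z hz
    rw [volDensity_eq_one hκ hz]
    simp [herm, hα_def]
  rw [integral_congr_ae hleft, integral_congr_ae hright, integral_add hR
    (integrable_finsetSum _ fun i _ => integrable_dzbar (hu i) (huc i) i),
    integral_finsetSum _ fun i _ => integrable_dzbar (hu i) (huc i) i]
  rw [Finset.sum_eq_zero fun i _ => integral_dzbar (hu i) (huc i) i, add_zero]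

lemma isZeroMode_radialForm {κ : ℝ} {hκ : 0 < κ} {ℓ : ℤ} {h : C2 → ℂ}
    (hh : h ∈ radialSolutions κ hκ ℓ) : IsZeroMode κ ℓ (radialForm h) := by
  refine ⟨contDiffOn_radialForm hh.1, _, isDbarStar_radialForm hh, fun z hz => ?_⟩
  have hd := differentiableAt_of_contDiffOn hh.1 hz
  have hdbar : dbar (radialForm h) z = 0 := by
    have h1 := (hh.2 z hz).1
    simp only [dbar, radialForm_apply, Pi.smul_apply, smul_eq_mul, dzbar_const,
      dzbar_mul hd (differentiable_coord _ z), dzbar_coord, mul_zero, zero_add, h1, sub_self]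
    rfl
  have hs : (s z : ℂ) ≠ 0 := by exact_mod_cast (s_pos hz).ne'
  have hF : (F κ z : ℂ) ≠ 0 := by exact_mod_cast (F_pos hκ z).ne'
  set c : ℝ := √κ / (2 * s z ^ 2 * F κ z) with hc
  have hpot : potential κ z = (0, (c : ℂ) • z) := rfl
  have hconn1 : (connection κ ℓ z).1 = (-(ℓ * c) : ℂ) • star z := by
    funext i
    simp [connection, hpot, OneForm.conj, mul_assoc]
  have hconn2 : (connection κ ℓ z).2 = (ℓ * c : ℂ) • z := by
    funext i
    simp [connection, hpot, OneForm.conj, mul_assoc]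
  have hsharp : sharp κ z (connection κ ℓ z) = (-(ℓ * c) * F κ z : ℂ) • star z := by
    rw [sharp, hconn1, mulVec_smul, metric_inv_mulVec_star hκ hz, smul_smul]
  rw [hdbar, clifford, hsharp, hconn2, radialForm_apply]
  refine Prod.ext ?_ (Prod.ext ?_ ?_)
  · simp only [Prod.fst_add, Prod.fst_sub, Prod.fst_zero, smul_dotProduct, dotProduct_smul,
      ← ofReal_s_eq_dotProduct, smul_eq_mul, hc]
    push_cast
    field_simp
    ring
  · simp
  · simp only [Prod.snd_add, Prod.snd_sub, Prod.snd_zero, Pi.smul_apply, smul_eq_mul]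
    ring

/-! ### The modes are zero modes -/

lemma hasDerivAt_radial_f {κ t : ℝ} (hκ : 0 < κ) (ht : 0 < t) :
    HasDerivAt (fun t : ℝ => √(1 + κ / t ^ 2) + √κ / t)
      (-(√κ / (t ^ 2 * √(1 + κ / t ^ 2))) * (√(1 + κ / t ^ 2) + √κ / t)) t := by
  have hpos : 0 < 1 + κ / t ^ 2 := by positivity
  have hF : 0 < √(1 + κ / t ^ 2) := Real.sqrt_pos.2 hpos
  have h1 : HasDerivAt (fun t : ℝ => 1 + κ / t ^ 2) (-(2 * κ / t ^ 3)) t := by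
    have h := ((hasDerivAt_const t κ).div (hasDerivAt_pow 2 t) (by positivity)).const_add 1
    refine h.congr_deriv ?_
    field_simp
    ring
  have h2 : HasDerivAt (fun t : ℝ => √κ / t) (-(√κ / t ^ 2)) t := by
    have h := (hasDerivAt_const t √κ).div (hasDerivAt_id t) ht.ne'
    refine h.congr_deriv ?_
    simp
    ring
  refine ((h1.sqrt hpos.ne').add h2).congr_deriv ?_
  have hsq : √κ * √κ = κ := Real.mul_self_sqrt hκ.le
  generalize √(1 + κ / t ^ 2) = X at *
  field_simp
  linear_combination hsq

lemma hasDerivAt_radial_weight {κ t : ℝ} (hκ : 0 < κ) (ht : 0 < t) (r : ℝ) (n : ℕ) :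
    HasDerivAt (fun t : ℝ => (t ^ n * (√(1 + κ / t ^ 2) + √κ / t) ^ r)⁻¹)
      ((-n / t + r * (√κ / (t ^ 2 * √(1 + κ / t ^ 2)))) *
        (t ^ n * (√(1 + κ / t ^ 2) + √κ / t) ^ r)⁻¹) t := by
  have hF : 0 < √(1 + κ / t ^ 2) := Real.sqrt_pos.2 (by positivity)
  have hf : 0 < √(1 + κ / t ^ 2) + √κ / t := by positivity
  have h1 := (hasDerivAt_radial_f hκ ht).rpow_const (p := r) (Or.inl hf.ne')
  have h2 := ((hasDerivAt_pow n t).mul h1).inv (by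
    have := Real.rpow_pos_of_pos hf r
    simp only [Pi.mul_apply]
    positivity)
  refine h2.congr_deriv ?_
  have h3 : (√(1 + κ / t ^ 2) + √κ / t) ^ (r - 1) * (√(1 + κ / t ^ 2) + √κ / t) =
      (√(1 + κ / t ^ 2) + √κ / t) ^ r := by
    rw [Real.rpow_sub_one hf.ne', div_mul_cancel₀ _ hf.ne']
  have h4 : (n : ℝ) * t ^ (n - 1) * t = n * t ^ n := by
    rcases n with _ | n
    · simp
    · simp [pow_succ, mul_assoc]
  have hr := Real.rpow_pos_of_pos hf r
  simp only [Pi.mul_apply]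
  rw [← h3] at hr ⊢
  generalize (√(1 + κ / t ^ 2) + √κ / t) ^ (r - 1) = Y at *
  generalize √(1 + κ / t ^ 2) + √κ / t = X at *
  generalize √(1 + κ / t ^ 2) = Z at *
  have hY : Y ≠ 0 := left_ne_zero_of_mul hr.ne'
  field_simp
  linear_combination (-(t * Z)) * h4

lemma euler_monomialFun (a b : ℕ) (z : C2) :
    ∑ i, star (z i) * dzbar i (fun y => star (monomialFun a b y)) z =
      (a + b : ℕ) * star (monomialFun a b z) := by
  have hd := fun j => differentiable_star_coord j z
  have e : (fun y => star (monomialFun a b y)) = fun y : C2 => star (y 0) ^ a * star (y 1) ^ b := by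
    funext y
    simp [monomialFun]
  have e' : star (monomialFun a b z) = star (z 0) ^ a * star (z 1) ^ b := congrFun e z
  have hp : ∀ (x : ℂ) (k : ℕ), (k : ℂ) * x ^ (k - 1) * x = k * x ^ k := by
    rintro x (_ | k)
    · simp
    · simp [pow_succ, mul_assoc]
  rw [e, e']
  simp only [dzbar_mul ((hd 0).fun_pow a) ((hd 1).fun_pow b), dzbar_pow (hd _), dzbar_star_coord,
    Fin.sum_univ_two]
  simp only [Fin.isValue, if_true, zero_ne_one, one_ne_zero, if_false]
  push_cast
  linear_combination star (z 1) ^ b * hp (star (z 0)) a + star (z 0) ^ a * hp (star (z 1)) b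

lemma modeCoeff_mem_radialSolutions {κ : ℝ} (hκ : 0 < κ) (ℓ : ℤ) (a b : ℕ) :
    modeCoeff κ ℓ a b ∈ radialSolutions κ hκ ℓ := by
  refine ⟨contDiffOn_modeCoeff hκ ℓ a b, fun z hz => ?_⟩
  have hs := s_pos hz
  have hQ := hasDerivAt_radial_weight hκ hs ((ℓ : ℝ) / 2) (a + b + 2)
  have hFpos := F_pos hκ z
  have hM : DifferentiableAt ℝ (monomialFun a b) z :=
    (contDiff_monomialFun a b).differentiable (by simp) z
  have hMs : DifferentiableAt ℝ (fun y => star (monomialFun a b y)) z := hM.star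
  have e1 : modeCoeff κ ℓ a b = fun y => monomialFun a b y * (((√(1 + κ / s y ^ 2))⁻¹ *
      (s y ^ (a + b + 2) * (√(1 + κ / s y ^ 2) + √κ / s y) ^ ((ℓ : ℝ) / 2))⁻¹ : ℝ) : ℂ) := by
    funext y
    rw [modeCoeff, div_eq_mul_inv, ← Complex.ofReal_inv, mul_assoc (F κ y), mul_inv (F κ y)]
    rfl
  have e2 : (fun y => (F κ y : ℂ) * star (modeCoeff κ ℓ a b y)) = fun y =>
      star (monomialFun a b y) * (((s y ^ (a + b + 2) *
        (√(1 + κ / s y ^ 2) + √κ / s y) ^ ((ℓ : ℝ) / 2))⁻¹ : ℝ) : ℂ) := by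
    funext y
    have hF : (F κ y : ℂ) ≠ 0 := by exact_mod_cast (F_pos hκ y).ne'
    rw [e1]
    change (F κ y : ℂ) * star (monomialFun a b y * (((F κ y)⁻¹ * _ : ℝ) : ℂ)) = _
    rw [star_mul', Complex.star_def, Complex.conj_ofReal, Complex.ofReal_mul, Complex.ofReal_inv]
    field_simp
  constructor
  · have hd : DifferentiableAt ℝ (fun t : ℝ => (√(1 + κ / t ^ 2))⁻¹) (s z) := by
      have hpos : 0 < 1 + κ / s z ^ 2 := by positivity
      refine DifferentiableAt.inv (DifferentiableAt.sqrt ?_ hpos.ne') (Real.sqrt_pos.2 hpos).ne'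
      exact (differentiableAt_const _).add ((differentiableAt_const _).div
        (differentiableAt_id.pow 2) (by positivity))
    have hq := hd.hasDerivAt.mul hQ
    have hMz : ∀ i, dzbar i (monomialFun a b) z = 0 := by
      intro i
      change dzbar i (fun y => y 0 ^ a * y 1 ^ b) z = 0
      rw [dzbar_mul ((differentiable_coord 0 z).fun_pow a) ((differentiable_coord 1 z).fun_pow b),
        dzbar_pow (differentiable_coord 0 z), dzbar_pow (differentiable_coord 1 z), dzbar_coord,
        dzbar_coord]
      simp
    have hr := fun i => dzbar_radial hq i
    have hdr := differentiableAt_radial hq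
    simp only [Pi.mul_apply] at hr hdr
    rw [e1]
    simp only [dzbar_mul hM hdr, hr, hMz]
    ring
  · have e3 : (F κ z : ℂ) * star (modeCoeff κ ℓ a b z) = star (monomialFun a b z) *
        (((s z ^ (a + b + 2) *
          (√(1 + κ / s z ^ 2) + √κ / s z) ^ ((ℓ : ℝ) / 2))⁻¹ : ℝ) : ℂ) := congrFun e2 z
    have hF : (F κ z : ℂ) ≠ 0 := by exact_mod_cast hFpos.ne'
    have hsC : (s z : ℂ) ≠ 0 := by exact_mod_cast hs.ne'
    have e4 : star (modeCoeff κ ℓ a b z) = (F κ z : ℂ)⁻¹ * (star (monomialFun a b z) *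
        (((s z ^ (a + b + 2) *
          (√(1 + κ / s z ^ 2) + √κ / s z) ^ ((ℓ : ℝ) / 2))⁻¹ : ℝ) : ℂ)) := by
      rw [← e3]
      field_simp
    have he := euler_monomialFun a b z
    have hsz := ofReal_s z
    rw [e2, e3, e4]
    have hdQ := differentiableAt_radial hQ
    have hdz := fun i => dzbar_radial hQ i
    simp only [dzbar_mul hMs hdQ, hdz]
    change _ = (ℓ : ℂ) / 2 * _ * ((F κ z : ℂ)⁻¹ * _)
    have hFz : √(1 + κ / s z ^ 2) = F κ z := rfl
    have hfz : F κ z + √κ / s z = f κ z := rfl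
    rw [hFz, hfz]
    generalize (s z ^ (a + b + 2) * f κ z ^ ((ℓ : ℝ) / 2))⁻¹ = Q
    simp only [Fin.sum_univ_two] at he ⊢
    push_cast at he ⊢
    have hstep : ((-((a : ℂ) + b + 2) / s z + ℓ / 2 * (√κ / (s z ^ 2 * F κ z))) * Q) * (s z : ℂ) =
        (-((a : ℂ) + b + 2) + ℓ / 2 * (√κ / (s z * F κ z))) * Q := by
      field_simp
    have hfin : (ℓ : ℂ) / 2 * (√κ / s z) * ((F κ z : ℂ)⁻¹ * (star (monomialFun a b z) * Q)) =
        ℓ / 2 * (√κ / (s z * F κ z)) * (star (monomialFun a b z) * Q) := by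
      field_simp
    rw [hfin]
    linear_combination Q * he + star (monomialFun a b z) * hstep -
      star (monomialFun a b z) *
        ((-((a : ℂ) + b + 2) / s z + ℓ / 2 * (√κ / (s z ^ 2 * F κ z))) * Q) * hsz

lemma modeSpace_le_map_radialSolutions {κ : ℝ} (hκ : 0 < κ) (ℓ : ℤ) :
    modeSpace κ ℓ ≤ (radialSolutions κ hκ ℓ).map radialForm := by
  refine Submodule.span_le.2 ?_
  rintro _ ⟨a, b, rfl⟩
  exact ⟨_, modeCoeff_mem_radialSolutions hκ ℓ a b, rfl⟩

lemma isZeroMode_of_mem_modeSpace {κ : ℝ} (hκ : 0 < κ) {ℓ : ℤ} {σ : SpinorField}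
    (hσ : σ ∈ modeSpace κ ℓ) : IsZeroMode κ ℓ σ := by
  obtain ⟨h, hh, rfl⟩ := modeSpace_le_map_radialSolutions hκ ℓ hσ
  exact isZeroMode_radialForm hh

/-! ### Normalisable radial forms -/

lemma continuous_s : Continuous s := contDiff_s.continuous

lemma measurable_F (κ : ℝ) : Measurable (F κ) :=
  (measurable_const.add (measurable_const.div (continuous_s.measurable.pow_const 2))).sqrt

lemma measurable_f (κ : ℝ) : Measurable (f κ) :=
  (measurable_F κ).add (measurable_const.div continuous_s.measurable)

lemma measurable_modeCoeff (κ : ℝ) (ℓ : ℤ) (a b : ℕ) : Measurable (modeCoeff κ ℓ a b) :=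
  (contDiff_monomialFun a b).continuous.measurable.div (Complex.measurable_ofReal.comp
    (((measurable_F κ).mul (continuous_s.measurable.pow_const _)).mul
      ((measurable_f κ).pow_const _)))

/-- The factor relating the modulus of `h` to the pointwise norm of `h (z₁ dz̄₁ + z₂ dz̄₂)`. -/
noncomputable def radialWeight (κ : ℝ) (z : C2) : ℝ := √(F κ z * s z)

lemma measurable_radialWeight (κ : ℝ) : Measurable (radialWeight κ) :=
  ((measurable_F κ).mul continuous_s.measurable).sqrt

lemma norm_mul_radialWeight_sq {κ : ℝ} (hκ : 0 < κ) (c : ℂ) (z : C2) :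
    ‖c * (radialWeight κ z : ℂ)‖ ^ 2 = ‖c‖ ^ 2 * (F κ z * s z) := by
  have h : 0 ≤ F κ z * s z := mul_nonneg (F_pos hκ z).le (s_nonneg z)
  rw [norm_mul, mul_pow, Complex.norm_real, radialWeight, Real.norm_eq_abs, sq_abs, Real.sq_sqrt h]

lemma aestronglyMeasurable_mul_radialWeight (κ : ℝ) {h : C2 → ℂ} (hh : Measurable h) :
    AEStronglyMeasurable (fun z => h z * (radialWeight κ z : ℂ)) volume :=
  (hh.mul (Complex.measurable_ofReal.comp (measurable_radialWeight κ))).aestronglyMeasurable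

lemma isL2_radialForm_iff {κ : ℝ} (hκ : 0 < κ) {h : C2 → ℂ} (hh : Measurable h) :
    IsL2 κ (radialForm h) ↔ MemLp (fun z => h z * (radialWeight κ z : ℂ)) 2 volume := by
  have hne : ∀ᵐ z : C2, z ≠ 0 := by simp [ae_iff]
  have hm : Measurable (radialForm h) :=
    measurable_const.prodMk ((hh.smul measurable_id).prodMk measurable_const)
  rw [memLp_two_iff_integrable_sq_norm (aestronglyMeasurable_mul_radialWeight κ hh), IsL2,
    and_iff_right hm.aestronglyMeasurable]
  refine integrable_congr ?_
  filter_upwards [hne] with z hz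
  rw [herm_radialForm hκ hz, volDensity_eq_one hκ hz, mul_one, norm_mul_radialWeight_sq hκ]

/-- The coefficients of the normalisable radial forms. -/
def normalisableCoeff (κ : ℝ) : Submodule ℂ (C2 → ℂ) where
  carrier := {h | Measurable h ∧ MemLp (fun z => h z * (radialWeight κ z : ℂ)) 2 volume}
  zero_mem' := ⟨measurable_const, by simp⟩
  add_mem' := by
    rintro h k ⟨hh, hh'⟩ ⟨hk, hk'⟩
    exact ⟨hh.add hk, (hh'.add hk').congr_norm
      (aestronglyMeasurable_mul_radialWeight κ (hh.add hk)) (by simp [add_mul])⟩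
  smul_mem' := by
    rintro c h ⟨hh, hh'⟩
    exact ⟨hh.const_smul c, (hh'.const_smul c).congr_norm
      (aestronglyMeasurable_mul_radialWeight κ (hh.const_smul c)) (by simp [mul_assoc])⟩

/-- The space of normalisable radial forms. -/
def normalisable (κ : ℝ) : Submodule ℂ SpinorField := (normalisableCoeff κ).map radialForm

lemma radialForm_mem_normalisable {κ : ℝ} (hκ : 0 < κ) {h : C2 → ℂ} (hh : Measurable h) :
    radialForm h ∈ normalisable κ ↔ IsL2 κ (radialForm h) := by
  constructor
  · rintro ⟨k, hk, hkh⟩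
    rw [← hkh, isL2_radialForm_iff hκ hk.1]
    exact hk.2
  · exact fun h2 => ⟨h, ⟨hh, (isL2_radialForm_iff hκ hh).1 h2⟩, rfl⟩

lemma exists_measurable_of_mem_modeSpace {κ : ℝ} {ℓ : ℤ} {σ : SpinorField}
    (hσ : σ ∈ modeSpace κ ℓ) : ∃ h, Measurable h ∧ σ = radialForm h := by
  induction hσ using Submodule.span_induction with
  | mem σ hσ =>
    obtain ⟨a, b, rfl⟩ := hσ
    exact ⟨_, measurable_modeCoeff κ ℓ a b, rfl⟩
  | zero => exact ⟨0, measurable_const, (map_zero _).symm⟩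
  | add σ τ _ _ hσ hτ =>
    obtain ⟨h, hh, rfl⟩ := hσ
    obtain ⟨k, hk, rfl⟩ := hτ
    exact ⟨h + k, hh.add hk, (map_add _ _ _).symm⟩
  | smul c σ _ hσ =>
    obtain ⟨h, hh, rfl⟩ := hσ
    exact ⟨c • h, hh.const_smul c, (map_smul _ _ _).symm⟩

lemma mem_normalisable_iff {κ : ℝ} (hκ : 0 < κ) {ℓ : ℤ} {σ : SpinorField}
    (hσ : σ ∈ modeSpace κ ℓ) : σ ∈ normalisable κ ↔ IsL2 κ σ := by
  obtain ⟨h, hh, rfl⟩ := exists_measurable_of_mem_modeSpace hσ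
  exact radialForm_mem_normalisable hκ hh

lemma measurePreserving_mulVec {U : Matrix (Fin 2) (Fin 2) ℂ} (hU : Uᴴ * U = 1) :
    MeasurePreserving (fun z : C2 => U *ᵥ z) volume volume := by
  let L : C2 →ₗ[ℝ] C2 := (toLin' U).restrictScalars ℝ
  have hdet : LinearMap.det L = 1 := by
    have h1 : star U.det * U.det = 1 := by
      rw [← det_conjTranspose, ← det_mul, hU, det_one]
    have h2 : Complex.normSq U.det = 1 := by
      have h3 : ((Complex.normSq U.det : ℝ) : ℂ) = 1 := by
        rw [Complex.normSq_eq_conj_mul_self]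
        exact h1
      exact_mod_cast h3
    rw [LinearMap.det_restrictScalars, LinearMap.det_toLin', Algebra.norm_complex_apply, h2]
  refine ⟨(L.continuous_of_finiteDimensional).measurable, ?_⟩
  have h := Measure.map_linearMap_addHaar_eq_smul_addHaar (volume : Measure C2)
    (f := L) (by rw [hdet]; exact one_ne_zero)
  rw [hdet, inv_one, abs_one, ENNReal.ofReal_one, one_smul] at h
  exact h

lemma pullback_mem_normalisable {κ : ℝ} {U : Matrix (Fin 2) (Fin 2) ℂ} (hU : Uᴴ * U = 1)
    {σ : SpinorField} (hσ : σ ∈ normalisable κ) : pullback U σ ∈ normalisable κ := by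
  obtain ⟨h, ⟨hh, hh'⟩, rfl⟩ := hσ
  rw [pullback_radialForm hU]
  have hp := measurePreserving_mulVec hU
  refine ⟨_, ⟨hh.comp hp.measurable, ?_⟩, rfl⟩
  have h2 := hh'.comp_measurePreserving hp
  have e : (fun z => h z * (radialWeight κ z : ℂ)) ∘ (fun z : C2 => U *ᵥ z) =
      fun z => h (U *ᵥ z) * (radialWeight κ z : ℂ) := by
    funext z
    simp only [Function.comp_apply, radialWeight, F_mulVec κ hU, s_mulVec hU]
  rwa [e] at h2

/-! ### Comparison with functions of the maximum norm -/

lemma norm_sq_le_s (z : C2) : ‖z‖ ^ 2 ≤ s z := by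
  have h : ‖z‖ ≤ √(s z) := by
    refine (pi_norm_le_iff_of_nonneg (Real.sqrt_nonneg _)).2 (Fin.forall_fin_two.2 ⟨?_, ?_⟩) <;>
      refine Real.le_sqrt_of_sq_le ?_ <;> rw [← Complex.normSq_eq_norm_sq]
    · exact le_add_of_nonneg_right (Complex.normSq_nonneg _)
    · exact le_add_of_nonneg_left (Complex.normSq_nonneg _)
  calc ‖z‖ ^ 2 ≤ √(s z) ^ 2 := by gcongr
    _ = s z := Real.sq_sqrt (s_nonneg z)

lemma s_le_norm_sq (z : C2) : s z ≤ 2 * ‖z‖ ^ 2 := by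
  have h : ∀ i, Complex.normSq (z i) ≤ ‖z‖ ^ 2 := fun i => by
    rw [Complex.normSq_eq_norm_sq]
    gcongr
    exact norm_le_pi_norm z i
  have h0 := h 0
  have h1 := h 1
  unfold s
  linarith

lemma finrank_C2 : Module.finrank ℝ C2 = 4 := by
  rw [Module.finrank_pi_fintype]
  simp [Complex.finrank_real_complex]

lemma F_mul_s_sq {κ : ℝ} (hκ : 0 < κ) {z : C2} (hz : z ≠ 0) :
    (F κ z * s z) ^ 2 = s z ^ 2 + κ := by
  have hs := s_pos hz
  rw [mul_pow, F, Real.sq_sqrt (by positivity)]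
  field_simp

lemma f_mul_s {κ : ℝ} {z : C2} (hz : z ≠ 0) : f κ z * s z = F κ z * s z + √κ := by
  have hs := s_pos hz
  rw [f, F]
  field_simp

lemma F_le_f {κ : ℝ} (z : C2) : F κ z ≤ f κ z := by
  have := s_nonneg z
  exact le_add_of_nonneg_right (by positivity)

lemma one_le_F {κ : ℝ} (hκ : 0 < κ) (z : C2) : 1 ≤ F κ z := by
  refine Real.one_le_sqrt.2 ?_
  have : 0 ≤ κ / s z ^ 2 := by positivity
  linarith

lemma one_le_f {κ : ℝ} (hκ : 0 < κ) (z : C2) : 1 ≤ f κ z := (one_le_F hκ z).trans (F_le_f z)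

lemma modeCoeff_norm_sq {κ : ℝ} (hκ : 0 < κ) (ℓ : ℤ) (a b : ℕ) {z : C2} (hz : z ≠ 0) :
    ‖modeCoeff κ ℓ a b z‖ ^ 2 * (F κ z * s z) =
      Complex.normSq (z 0) ^ a * Complex.normSq (z 1) ^ b *
        (F κ z * s z ^ (2 * (a + b) + 3) * f κ z ^ ℓ)⁻¹ := by
  have hs := s_pos hz
  have hF := F_pos hκ z
  have hf := f_pos hκ z
  have hfl : (f κ z ^ ((ℓ : ℝ) / 2)) ^ 2 = f κ z ^ ℓ := by
    rw [← Real.rpow_natCast, ← Real.rpow_mul hf.le, ← Real.rpow_intCast]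
    congr 1
    push_cast
    ring
  have hden : 0 < F κ z * s z ^ (a + b + 2) * f κ z ^ ((ℓ : ℝ) / 2) := by positivity
  rw [modeCoeff, norm_div, div_pow, Complex.norm_real, Real.norm_eq_abs, sq_abs, mul_pow _ (f κ z ^ _),
    hfl, norm_mul, mul_pow, norm_pow, norm_pow, Complex.normSq_eq_norm_sq, Complex.normSq_eq_norm_sq]
  have hfz : 0 < f κ z ^ ℓ := by positivity
  field_simp
  ring

lemma integrable_comparison {κ : ℝ} (hκ : 0 < κ) :
    Integrable (fun z : C2 => (‖z‖ ^ 2 * (‖z‖ ^ 4 + κ))⁻¹) volume := by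
  rw [integrable_fun_norm_addHaar volume (f := fun y : ℝ => (y ^ 2 * (y ^ 4 + κ))⁻¹), finrank_C2]
  have hK : 0 < κ⁻¹ + 1 := by positivity
  refine ((integrable_inv_one_add_sq.const_mul (2 * (κ⁻¹ + 1))).integrableOn).mono' ?_ ?_
  · have : Measurable fun y : ℝ => y ^ (4 - 1) • (y ^ 2 * (y ^ 4 + κ))⁻¹ := by fun_prop
    exact this.aestronglyMeasurable
  · refine (ae_restrict_iff' measurableSet_Ioi).2 (Filter.Eventually.of_forall fun y hy => ?_)
    have hy : 0 < y := hy
    rw [Real.norm_of_nonneg (by positivity), smul_eq_mul, ← div_eq_mul_inv, ← div_eq_mul_inv,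
      div_le_div_iff₀ (by positivity) (by positivity)]
    have h1 : y * (1 + y ^ 2) ≤ 2 * (1 + y ^ 4) := by
      nlinarith [sq_nonneg (y - 1), sq_nonneg (y ^ 2 - y), sq_nonneg (y ^ 2 - 1)]
    have h2 : 1 + y ^ 4 ≤ (κ⁻¹ + 1) * (y ^ 4 + κ) := by
      have h3 : (κ⁻¹ + 1) * (y ^ 4 + κ) = 1 + y ^ 4 + (κ⁻¹ * y ^ 4 + κ) := by
        field_simp
        ring
      rw [h3]
      exact le_add_of_nonneg_right (by positivity)
    calc y ^ (4 - 1) * (1 + y ^ 2) = y ^ 2 * (y * (1 + y ^ 2)) := by ring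
      _ ≤ y ^ 2 * (2 * ((κ⁻¹ + 1) * (y ^ 4 + κ))) :=
        mul_le_mul_of_nonneg_left (by linarith) (by positivity)
      _ = 2 * (κ⁻¹ + 1) * (y ^ 2 * (y ^ 4 + κ)) := by ring

lemma mode_mem_normalisable {κ : ℝ} (hκ : 0 < κ) {ℓ : ℤ} {a b : ℕ}
    (h : ((a + b + 1 : ℕ) : ℤ) ≤ ℓ) : mode κ ℓ a b ∈ normalisable κ := by
  have hm := measurable_modeCoeff κ ℓ a b
  refine ⟨_, ⟨hm, ?_⟩, rfl⟩
  have hae := aestronglyMeasurable_mul_radialWeight κ hm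
  rw [memLp_two_iff_integrable_sq_norm hae]
  have hne : ∀ᵐ z : C2, z ≠ 0 := by simp [ae_iff]
  refine ((integrable_comparison hκ).const_mul ((√κ ^ (a + b))⁻¹)).mono' (hae.norm.pow 2) ?_
  filter_upwards [hne] with z hz
  rw [Real.norm_of_nonneg (by positivity), norm_mul_radialWeight_sq hκ, modeCoeff_norm_sq hκ ℓ a b hz]
  have hs := s_pos hz
  have hF := F_pos hκ z
  have hf := f_pos hκ z
  have hρ : 0 < ‖z‖ := norm_pos_iff.2 hz
  have hsκ : 0 < √κ := Real.sqrt_pos.2 hκ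
  have hρs := norm_sq_le_s z
  have h0 : Complex.normSq (z 0) ≤ s z := le_add_of_nonneg_right (Complex.normSq_nonneg _)
  have h1 : Complex.normSq (z 1) ≤ s z := le_add_of_nonneg_left (Complex.normSq_nonneg _)
  have hfl : f κ z ^ (a + b + 1) ≤ f κ z ^ ℓ := by
    rw [← zpow_natCast]
    exact zpow_le_zpow_right₀ (one_le_f hκ z) h
  have hfs : √κ ≤ f κ z * s z := by
    rw [f_mul_s hz]
    exact le_add_of_nonneg_left (by positivity)
  have hFf : s z ^ 2 + κ ≤ F κ z * s z * (f κ z * s z) := by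
    rw [← F_mul_s_sq hκ hz, sq]
    gcongr
    exact F_le_f z
  calc Complex.normSq (z 0) ^ a * Complex.normSq (z 1) ^ b *
        (F κ z * s z ^ (2 * (a + b) + 3) * f κ z ^ ℓ)⁻¹
      ≤ s z ^ a * s z ^ b * (F κ z * s z ^ (2 * (a + b) + 3) * f κ z ^ (a + b + 1))⁻¹ := by
        have := Complex.normSq_nonneg (z 0)
        have := Complex.normSq_nonneg (z 1)
        gcongr
    _ = ((f κ z * s z) ^ (a + b) * (s z * (F κ z * s z * (f κ z * s z))))⁻¹ := by
        field_simp
        ring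
    _ ≤ (√κ ^ (a + b) * (‖z‖ ^ 2 * (‖z‖ ^ 4 + κ)))⁻¹ := by
        have h4 : ‖z‖ ^ 4 + κ ≤ F κ z * s z * (f κ z * s z) := by
          refine le_trans ?_ hFf
          have : ‖z‖ ^ 4 = (‖z‖ ^ 2) ^ 2 := by ring
          rw [this]
          gcongr
        gcongr
    _ = (√κ ^ (a + b))⁻¹ * (‖z‖ ^ 2 * (‖z‖ ^ 4 + κ))⁻¹ := by rw [mul_inv]

lemma not_integrableOn_ball_norm_inv_pow_four :
    ¬ IntegrableOn (fun z : C2 => (‖z‖ ^ 4)⁻¹) (Metric.ball 0 1) volume := by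
  rw [integrableOn_fun_norm_addHaar volume (f := fun y : ℝ => (y ^ 4)⁻¹), finrank_C2]
  intro h
  have h1 : IntegrableOn (fun y : ℝ => y⁻¹) (Set.Ioo 0 1) := by
    refine (integrableOn_congr_fun (fun y hy => ?_) measurableSet_Ioo).1 h
    have hy : 0 < y := hy.1
    simp only [smul_eq_mul]
    field_simp
  have h2 : IntervalIntegrable (fun y : ℝ => y⁻¹) volume 0 1 := by
    rw [intervalIntegrable_iff_integrableOn_Ioo_of_le zero_le_one]
    exact h1
  rw [intervalIntegrable_inv_iff] at h2
  simp at h2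

lemma le_of_multiplet_le_normalisable {κ : ℝ} (hκ : 0 < κ) {ℓ : ℤ} {n : ℕ}
    (h : multiplet κ ℓ n ≤ normalisable κ) : (n : ℤ) + 1 ≤ ℓ := by
  by_contra hlt
  have hlt : ℓ ≤ n := by omega
  have hint : ∀ p ∈ Finset.HasAntidiagonal.antidiagonal n, Integrable
      (fun z => (n.choose p.1 : ℝ) *
        ‖modeCoeff κ ℓ p.1 p.2 z * (radialWeight κ z : ℂ)‖ ^ 2) volume := by
    intro p hp
    have hm := measurable_modeCoeff κ ℓ p.1 p.2
    have h1 := h (mode_mem_multiplet κ ℓ (Finset.HasAntidiagonal.mem_antidiagonal.1 hp))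
    rw [mode_eq, radialForm_mem_normalisable hκ hm, isL2_radialForm_iff hκ hm,
      memLp_two_iff_integrable_sq_norm (aestronglyMeasurable_mul_radialWeight κ hm)] at h1
    exact h1.const_mul _
  have hsum := (integrable_finsetSum _ hint).integrableOn (s := Metric.ball 0 1)
  set K : ℝ := √(4 + κ) + √κ with hK
  have hKpos : 0 < K := by positivity
  refine not_integrableOn_ball_norm_inv_pow_four ?_
  refine (hsum.const_mul (4 * K ^ (n + 1))).mono' ?_ ?_
  · have : Measurable fun z : C2 => (‖z‖ ^ 4)⁻¹ := by fun_prop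
    exact this.aestronglyMeasurable
  have hne : ∀ᵐ z : C2, z ≠ 0 := by simp [ae_iff]
  rw [ae_restrict_iff' Metric.isOpen_ball.measurableSet]
  filter_upwards [hne] with z hz hball
  have hs := s_pos hz
  have hF := F_pos hκ z
  have hf := f_pos hκ z
  have hρ : 0 < ‖z‖ := norm_pos_iff.2 hz
  have hρ1 : ‖z‖ < 1 := by simpa using hball
  have hsρ := s_le_norm_sq z
  have hs2 : s z ≤ 2 := by nlinarith
  have e : ∑ p ∈ Finset.HasAntidiagonal.antidiagonal n, (n.choose p.1 : ℝ) *
      ‖modeCoeff κ ℓ p.1 p.2 z * (radialWeight κ z : ℂ)‖ ^ 2 =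
      s z ^ n * (F κ z * s z ^ (2 * n + 3) * f κ z ^ ℓ)⁻¹ := by
    have hb : s z ^ n = _ := (Commute.all (Complex.normSq (z 0)) (Complex.normSq (z 1))).add_pow' n
    rw [hb, Finset.sum_mul]
    refine Finset.sum_congr rfl fun p hp => ?_
    rw [norm_mul_radialWeight_sq hκ, modeCoeff_norm_sq hκ ℓ _ _ hz,
      Finset.HasAntidiagonal.mem_antidiagonal.1 hp, nsmul_eq_mul]
    ring
  rw [Real.norm_of_nonneg (by positivity), e]
  have hfl : f κ z ^ ℓ ≤ f κ z ^ n := by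
    rw [← zpow_natCast]
    exact zpow_le_zpow_right₀ (one_le_f hκ z) hlt
  have hfs : f κ z * s z ≤ K := by
    rw [f_mul_s hz, hK]
    gcongr
    refine Real.le_sqrt_of_sq_le ?_
    rw [F_mul_s_sq hκ hz]
    nlinarith
  have hsq : s z ^ 2 ≤ 4 * ‖z‖ ^ 4 := by
    calc s z ^ 2 ≤ (2 * ‖z‖ ^ 2) ^ 2 := by gcongr
      _ = 4 * ‖z‖ ^ 4 := by ring
  calc (‖z‖ ^ 4)⁻¹ = 4 * K ^ (n + 1) * (K ^ (n + 1) * (4 * ‖z‖ ^ 4))⁻¹ := by field_simp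
    _ ≤ 4 * K ^ (n + 1) * ((f κ z * s z) ^ (n + 1) * s z ^ 2)⁻¹ := by gcongr
    _ = 4 * K ^ (n + 1) * (s z ^ n * (f κ z * s z ^ (2 * n + 3) * f κ z ^ n)⁻¹) := by
        congr 1
        field_simp
        ring
    _ ≤ 4 * K ^ (n + 1) * (s z ^ n * (F κ z * s z ^ (2 * n + 3) * f κ z ^ ℓ)⁻¹) := by
        gcongr
        exact F_le_f z

/-! ### The normalisable combinations of modes -/

lemma le_of_mem_multiplet_of_mem_normalisable {κ : ℝ} (hκ : 0 < κ) {ℓ : ℤ} {n : ℕ}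
    {σ : SpinorField} (h0 : σ ≠ 0) (hσ : σ ∈ multiplet κ ℓ n) (hσ' : σ ∈ normalisable κ) :
    (n : ℤ) + 1 ≤ ℓ := by
  have hinv : IsSU2Invariant (multiplet κ ℓ n ⊓ normalisable κ) := fun U hU τ hτ =>
    ⟨isSU2Invariant_multiplet κ ℓ n U hU τ hτ.1,
      pullback_mem_normalisable (conjTranspose_mul_self_of_mem hU) hτ.2⟩
  rcases multiplet_irreducible κ ℓ n inf_le_left hinv with h | h
  · exact absurd ((Submodule.mem_bot ℂ).1 (h ▸ ⟨hσ, hσ'⟩ : σ ∈ (⊥ : Submodule ℂ SpinorField))) h0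
  · exact le_of_multiplet_le_normalisable hκ (inf_eq_left.1 h)

lemma mode_mem_modeSpace (κ : ℝ) (ℓ : ℤ) (a b : ℕ) : mode κ ℓ a b ∈ modeSpace κ ℓ :=
  Submodule.subset_span ⟨a, b, rfl⟩

lemma isL2_mode_iff {κ : ℝ} (hκ : 0 < κ) (ℓ : ℤ) (a b : ℕ) :
    IsL2 κ (mode κ ℓ a b) ↔ ((a + b + 1 : ℕ) : ℤ) ≤ ℓ := by
  rw [← mem_normalisable_iff hκ (mode_mem_modeSpace κ ℓ a b)]
  refine ⟨fun h => ?_, mode_mem_normalisable hκ⟩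
  exact_mod_cast le_of_mem_multiplet_of_mem_normalisable hκ
    ((linearIndependent_mode hκ ℓ).ne_zero (a, b)) (mode_mem_multiplet κ ℓ rfl) h

lemma multiplet_le_modeSpace (κ : ℝ) (ℓ : ℤ) (n : ℕ) : multiplet κ ℓ n ≤ modeSpace κ ℓ :=
  Submodule.span_mono fun _ ⟨a, b, _, h⟩ => ⟨a, b, h⟩

lemma modeSpace_le_iSup_multiplet (κ : ℝ) (ℓ : ℤ) : modeSpace κ ℓ ≤ ⨆ n, multiplet κ ℓ n := by
  refine Submodule.span_le.2 ?_
  rintro _ ⟨a, b, rfl⟩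
  exact Submodule.mem_iSup_of_mem (a + b) (mode_mem_multiplet κ ℓ rfl)

lemma pullback_phase_of_mem_multiplet (κ : ℝ) (ℓ : ℤ) {n : ℕ} {c : ℂ} (hc : star c * c = 1)
    {σ : SpinorField} (hσ : σ ∈ multiplet κ ℓ n) :
    pullback (c • (1 : Matrix (Fin 2) (Fin 2) ℂ)) σ = c ^ n • σ := by
  have hU : (c • (1 : Matrix (Fin 2) (Fin 2) ℂ))ᴴ * (c • (1 : Matrix (Fin 2) (Fin 2) ℂ)) = 1 := by
    rw [conjTranspose_smul, conjTranspose_one, smul_mul_smul_comm, hc, one_mul, one_smul]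
  suffices multiplet κ ℓ n ≤ LinearMap.eqLocus
      (pullbackLinear (c • (1 : Matrix (Fin 2) (Fin 2) ℂ))) (c ^ n • LinearMap.id) from this hσ
  refine Submodule.span_le.2 ?_
  rintro _ ⟨a, b, rfl, rfl⟩
  change pullback _ _ = c ^ (a + b) • mode κ ℓ a b
  rw [mode_eq_homForm, pullback_homForm κ ℓ _ hU, ← map_smul (homForm κ ℓ (a + b))]
  congr 1
  funext z
  simp only [monomialFun, smul_mulVec, one_mulVec, Pi.smul_apply, smul_eq_mul]
  ring

lemma mem_iSup_multiplet_iff {κ : ℝ} (hκ : 0 < κ) (ℓ : ℤ) (σ : SpinorField) :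
    σ ∈ (⨆ n : ℕ, ⨆ _ : (n : ℤ) + 1 ≤ ℓ, multiplet κ ℓ n) ↔
      σ ∈ modeSpace κ ℓ ∧ IsL2 κ σ := by
  constructor
  · intro hσ
    have h1 : (⨆ n : ℕ, ⨆ _ : (n : ℤ) + 1 ≤ ℓ, multiplet κ ℓ n) ≤
        modeSpace κ ℓ ⊓ normalisable κ := by
      refine iSup₂_le fun n hn => le_inf (multiplet_le_modeSpace κ ℓ n) (Submodule.span_le.2 ?_)
      rintro _ ⟨a, b, rfl, rfl⟩
      exact mode_mem_normalisable hκ (by exact_mod_cast hn)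
    obtain ⟨h2, h3⟩ := h1 hσ
    exact ⟨h2, (mem_normalisable_iff hκ h2).1 h3⟩
  · rintro ⟨hσ, hL2⟩
    have hnorm := (mem_normalisable_iff hκ hσ).2 hL2
    obtain ⟨v, hv, rfl⟩ :=
      (Submodule.mem_iSup_iff_exists_finsupp _ _).1 (modeSpace_le_iSup_multiplet κ ℓ hσ)
    have hc : star (Complex.exp Complex.I) * Complex.exp Complex.I = 1 := by
      rw [Complex.star_def, ← Complex.exp_conj, Complex.conj_I, ← Complex.exp_add,
        neg_add_cancel, Complex.exp_zero]
    have hU : (Complex.exp Complex.I • (1 : Matrix (Fin 2) (Fin 2) ℂ))ᴴ *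
        (Complex.exp Complex.I • (1 : Matrix (Fin 2) (Fin 2) ℂ)) = 1 := by
      rw [conjTranspose_smul, conjTranspose_one, smul_mul_smul_comm, hc, one_mul, one_smul]
    have hcomp := mem_of_sum_mem_of_eigenvectors
      (pullbackLinear (Complex.exp Complex.I • (1 : Matrix (Fin 2) (Fin 2) ℂ))) (normalisable κ)
      (fun _ hx => pullback_mem_normalisable hU hx) (fun n => Complex.exp Complex.I ^ n) v.support v
      (fun n _ => pullback_phase_of_mem_multiplet κ ℓ hc (hv n))
      exp_I_pow_injective.injOn hnorm
    refine Submodule.sum_mem _ fun n hn => ?_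
    exact Submodule.mem_iSup_of_mem n (Submodule.mem_iSup_of_mem
      (le_of_mem_multiplet_of_mem_normalisable hκ (Finsupp.mem_support_iff.1 hn) (hv n)
        (hcomp n hn)) (hv n))

end EguchiHanson

theorem mainTheorem1 (κ : ℝ) (hκ : 0 < κ) (ℓ : ℤ) :
    -- every mode of the family is a zero mode of `D_𝒜`
    (∀ a b : ℕ, EguchiHanson.IsZeroMode κ ℓ (EguchiHanson.mode κ ℓ a b)) ∧
    -- normalisability: `1 ≤ 2 N + 1 ≤ ℓ`, where `2 N = a + b`
    (∀ a b : ℕ, EguchiHanson.IsL2 κ (EguchiHanson.mode κ ℓ a b) ↔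
      1 ≤ a + b + 1 ∧ ((a + b + 1 : ℕ) : ℤ) ≤ ℓ) ∧
    -- the modes are linearly independent, and all their combinations are zero modes
    LinearIndependent ℂ (fun p : ℕ × ℕ => EguchiHanson.mode κ ℓ p.1 p.2) ∧
    (∀ σ ∈ EguchiHanson.modeSpace κ ℓ, EguchiHanson.IsZeroMode κ ℓ σ) ∧
    -- the modes with `2 N = n` span an irreducible `SU(2)` multiplet of dimension `n + 1`
    (∀ n : ℕ,
      Module.finrank ℂ (EguchiHanson.multiplet κ ℓ n) = n + 1 ∧
      EguchiHanson.IsSU2Invariant (EguchiHanson.multiplet κ ℓ n) ∧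
      (∀ W : Submodule ℂ EguchiHanson.SpinorField, W ≤ EguchiHanson.multiplet κ ℓ n →
        EguchiHanson.IsSU2Invariant W → W = ⊥ ∨ W = EguchiHanson.multiplet κ ℓ n)) ∧
    -- the normalisable combinations form the sum of the multiplets with `2 N + 1 ≤ ℓ`,
    -- of dimension `ℓ (ℓ + 1) / 2`, and there are none for `ℓ = 0`
    (∃ V : Submodule ℂ EguchiHanson.SpinorField,
      (∀ σ, σ ∈ V ↔ σ ∈ EguchiHanson.modeSpace κ ℓ ∧ EguchiHanson.IsL2 κ σ) ∧
      V = (⨆ n : ℕ, ⨆ _ : (n : ℤ) + 1 ≤ ℓ, EguchiHanson.multiplet κ ℓ n) ∧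
      (0 ≤ ℓ → 2 * (Module.finrank ℂ V : ℤ) = ℓ * (ℓ + 1)) ∧
      (ℓ = 0 → V = ⊥)) := by
  open EguchiHanson in
  refine ⟨fun a b => isZeroMode_of_mem_modeSpace hκ (mode_mem_modeSpace κ ℓ a b), fun a b => ?_,
    linearIndependent_mode hκ ℓ, fun σ hσ => isZeroMode_of_mem_modeSpace hκ hσ, fun n =>
      ⟨finrank_multiplet hκ ℓ n, isSU2Invariant_multiplet κ ℓ n, fun W hle hW =>
        multiplet_irreducible κ ℓ n hle hW⟩,
    _, mem_iSup_multiplet_iff hκ ℓ, rfl, finrank_iSup_multiplet hκ, fun h0 => ?_⟩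
  · rw [EguchiHanson.isL2_mode_iff hκ]
    omega
  · exact eq_bot_iff.2 (iSup₂_le fun n hn => by omega)
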